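/- Let $m$ be a positive integer and let $B,A_{-1},A_0,A_1$ be entrywise nonnegative real $m\times m$ matrices such that the block tridiagonal matrix \[ P=\begin{bmatrix} B&A_1\\ A_{-1}&A_0&A_1\\ &A_{-1}&A_0&\ddots\\ &&\ddots&\ddots\end{bmatrix} \] on the state space $\mathbb N\times\{1,\dots,m\}$, $\mathbb N=\{0,1,2,\dots\}$, is row-stochastic (a quasi-birth-and-death process, QBD). Assume that $P$ is irreducible, that $A_{-1}+A_0+A_1$ is irreducible, and that the doubly infinite QBD, that is, the Markov chain on $\mathbb Z\times\{1,\dots,m\}$ with transition blocks $A_{-1}$ (one level down), $A_0$ (same level), $A_1$ (one level up), has exactly one final class, this class is $\mathbb Z\times\mathcal E_*$ for some nonempty $\mathcal E_*\subseteq\{1,\dots,m\}$, and every other state is on a path to it. Assume moreover that the QBD with transition matrix $P$ is not null recurrent, that is, it is positive recurrent or transient. Let $G$, $\widehat G$ and $R$ be the minimal nonnegative solutions of \[ A_{-1}+(A_0-I)X+A_1X^2=0,\qquad A_1+(A_0-I)X+A_{-1}X^2=0,\qquad A_1+X(A_0-I)+X^2A_{-1}=0 \] respectively (the entrywise smallest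 entrywise nonnegative solutions), and let \[ U=A_0+RA_{-1},\qquad W=\sum_{j=0}^\infty G^j(U-I)^{-1}R^j . \] Then $G$, $\widehat G$, $R$ exist, $U-I$ is nonsingular, the series $W$ converges, and the following holds. Let $M$ be any nonsingular complex $m\times m$ matrix such that \[ \widehat GM=M\begin{bmatrix}V_1&0\\0&V_0\end{bmatrix}, \] where $V_1$ is a nonsingular matrix of order $p$, $0\le p\le m$, and $V_0$ is a square matrix of order $m-p$ with spectral radius $0$. Partition $M=[\,L\;|\;K\,]$ and $M^{-1}=\begin{bmatrix}E\\F\end{bmatrix}$ with $L$ of size $m\times p$, $K$ of size $m\times(m-p)$, $E$ of size $p\times m$ and $F$ of size $(m-p)\times m$. Put \[ X_1=[\,I\;|\;L\,],\quad X_2=K,\quad T_1=\begin{bmatrix}G&0\\0&V_1^{-1}\end{bmatrix},\quad T_2=V_0,\quad Z_1=\begin{bmatrix}W\\-EW\end{bmatrix},\quad Z_2=-V_0FW, \] \[ X=[\,X_1\;|\;X_2\,],\qquad T=\begin{bmatrix}T_1&0\\0&T_2\end{bmatrix},\qquad Z=\begin{bmatrix}Z_1\\Z_2\end{bmatrix}.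 \] Then $(X,T,Z)$ is a resolvent triple of $\eta(\lambda)=A_{-1}+(A_0-I)\lambda+A_1\lambda^2$, in the following sense. A triple $(X,T,Z)$ with $X=[\,X_1\;|\;X_2\,]$, $T=\mathrm{diag}(T_1,T_2)$, $T_1$ of order $q$, $T_2$ of order $ml-q$, and corresponding sizes of $X_1,X_2,Z$ is a resolvent triple of an $m\times m$ matrix polynomial $B(\lambda)=\sum_{i=0}^lB_i\lambda^i$ of degree $l$ (so $B_l\ne0$) if (a) the $ml\times ml$ matrix with block rows $[\,X_1T_1^{i}\;|\;X_2T_2^{\,l-1-i}\,]$, $i=0,\dots,l-1$, is nonsingular; (b) $\sum_{i=0}^lB_iX_1T_1^i=0$ and $\sum_{i=0}^lB_iX_2T_2^{\,l-i}=0$; (c) $\det B(\lambda)$ is not identically zero and, with $T(\lambda)=\mathrm{diag}(\lambda I-T_1,\lambda T_2-I)$, for every $\lambda\in\mathbb C$ with $\det B(\lambda)\neq0$ the matrix $T(\lambda)$ is nonsingular and $B(\lambda)^{-1}=X\,T(\lambda)^{-1}Z$. -/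

import Mathlib

open scoped ENNReal

/-! ### Countable Markov chains: recurrence classification -/

/-- First passage probabilities of a chain with transition probabilities `P`:
`firstPassage P t n s` is the probability that the chain started in `s` is in `t` at time `n + 1`
and at none of the times `1, …, n`. -/
noncomputable def firstPassage {S : Type*} (P : Matrix S S ℝ) (t : S) : ℕ → S → ℝ≥0∞
  | 0, s => ENNReal.ofReal (P s t)
  | n + 1, s => ∑' r : {r : S // r ≠ t}, ENNReal.ofReal (P s r) * firstPassage P t n r

/-- The probability that the chain started in `s` ever returns to `s`. -/
noncomputable def returnProb {S : Type*} (P : Matrix S S ℝ) (s : S) : ℝ≥0∞ :=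
  ∑' n : ℕ, firstPassage P s n s

/-- The mean return time to `s`, on the event that the return takes place. -/
noncomputable def meanReturnTime {S : Type*} (P : Matrix S S ℝ) (s : S) : ℝ≥0∞ :=
  ∑' n : ℕ, ((n : ℝ≥0∞) + 1) * firstPassage P s n s

/-- The chain is transient: from every state there is a positive probability of no return. -/
def IsTransientChain {S : Type*} (P : Matrix S S ℝ) : Prop :=
  ∀ s, returnProb P s < 1

/-- The chain is positive recurrent: from every state the return is certain and takes place in
finite mean time. -/
def IsPositiveRecurrentChain {S : Type*} (P : Matrix S S ℝ) : Prop :=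
  ∀ s, returnProb P s = 1 ∧ meanReturnTime P s < ⊤

/-- State `t` can be reached from state `s` in zero or more steps of positive probability. -/
def Reaches {S : Type*} (P : Matrix S S ℝ) (s t : S) : Prop :=
  Relation.ReflTransGen (fun a b => 0 < P a b) s t

/-! ### Quasi-birth-and-death processes -/

/-- The blocks of the transition matrix of a QBD process with phase set `{1, …, m}`.
The row sum conditions say that the transition matrix is row-stochastic. -/
structure QBD (m : ℕ) where
  /-- transitions from level `0` to level `0` -/
  B : Matrix (Fin m) (Fin m) ℝ
  /-- transitions one level down: `A_{-1}` -/
  Adown : Matrix (Fin m) (Fin m) ℝ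
  /-- transitions within a level other than level `0`: `A_0` -/
  A0 : Matrix (Fin m) (Fin m) ℝ
  /-- transitions one level up: `A_1` -/
  Aup : Matrix (Fin m) (Fin m) ℝ
  B_nonneg : ∀ i j, 0 ≤ B i j
  Adown_nonneg : ∀ i j, 0 ≤ Adown i j
  A0_nonneg : ∀ i j, 0 ≤ A0 i j
  Aup_nonneg : ∀ i j, 0 ≤ Aup i j
  boundary_row_sum : ∀ i, ∑ j, (B i j + Aup i j) = 1
  interior_row_sum : ∀ i, ∑ j, (Adown i j + A0 i j + Aup i j) = 1

/-- `X` is the minimal nonnegative matrix with the property `p`: it is the entrywise smallest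
among the entrywise nonnegative matrices with this property. -/
def IsMinimalNonneg {m : ℕ} (p : Matrix (Fin m) (Fin m) ℝ → Prop)
    (X : Matrix (Fin m) (Fin m) ℝ) : Prop :=
  (∀ i j, 0 ≤ X i j) ∧ p X ∧
    ∀ Y : Matrix (Fin m) (Fin m) ℝ, (∀ i j, 0 ≤ Y i j) → p Y → ∀ i j, X i j ≤ Y i j

open Classical in
/-- The minimal nonnegative matrix with the property `p` (zero if there is none). -/
noncomputable def minimalNonneg {m : ℕ} (p : Matrix (Fin m) (Fin m) ℝ → Prop) :
    Matrix (Fin m) (Fin m) ℝ :=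
  if h : ∃ X, IsMinimalNonneg p X then h.choose else 0

namespace QBD

variable {m : ℕ} (Q : QBD m)

/-- The transition matrix `P` of the QBD on the states `(level, phase)`, levels in `ℕ`. -/
def P : Matrix (ℕ × Fin m) (ℕ × Fin m) ℝ := fun s t =>
  if t.1 = s.1 + 1 then Q.Aup s.2 t.2
  else if t.1 = s.1 then (if s.1 = 0 then Q.B s.2 t.2 else Q.A0 s.2 t.2)
  else if t.1 + 1 = s.1 then Q.Adown s.2 t.2
  else 0

/-- The transition matrix of the doubly infinite QBD, with levels in `ℤ`. -/
def doublyInfinite : Matrix (ℤ × Fin m) (ℤ × Fin m) ℝ := fun s t =>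
  if t.1 = s.1 + 1 then Q.Aup s.2 t.2
  else if t.1 = s.1 then Q.A0 s.2 t.2
  else if t.1 = s.1 - 1 then Q.Adown s.2 t.2
  else 0

/-- The doubly infinite QBD has exactly one final class, it is of the form `ℤ × Es` with `Es`
nonempty, and every other state is on a path to it. -/
def HasUniqueFinalClass : Prop :=
  ∃ Es : Set (Fin m), Es.Nonempty ∧
    (∀ s t : ℤ × Fin m, s.2 ∈ Es → t.2 ∈ Es → Reaches Q.doublyInfinite s t) ∧
    (∀ s t : ℤ × Fin m, s.2 ∈ Es → Reaches Q.doublyInfinite s t → t.2 ∈ Es) ∧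
    (∀ s : ℤ × Fin m, ∃ t : ℤ × Fin m, t.2 ∈ Es ∧ Reaches Q.doublyInfinite s t)

/-- Not null recurrent: positive recurrent or transient. -/
def NotNullRecurrent : Prop :=
  IsPositiveRecurrentChain Q.P ∨ IsTransientChain Q.P

/-- `A_{-1} + (A_0 - I) X + A_1 X² = 0` -/
def GEquation (X : Matrix (Fin m) (Fin m) ℝ) : Prop :=
  Q.Adown + (Q.A0 - 1) * X + Q.Aup * X ^ 2 = 0

/-- `A_1 + (A_0 - I) X + A_{-1} X² = 0` -/
def GhatEquation (X : Matrix (Fin m) (Fin m) ℝ) : Prop :=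
  Q.Aup + (Q.A0 - 1) * X + Q.Adown * X ^ 2 = 0

/-- `A_1 + X (A_0 - I) + X² A_{-1} = 0` -/
def REquation (X : Matrix (Fin m) (Fin m) ℝ) : Prop :=
  Q.Aup + X * (Q.A0 - 1) + X ^ 2 * Q.Adown = 0

noncomputable def G : Matrix (Fin m) (Fin m) ℝ := minimalNonneg Q.GEquation

noncomputable def Ghat : Matrix (Fin m) (Fin m) ℝ := minimalNonneg Q.GhatEquation

noncomputable def R : Matrix (Fin m) (Fin m) ℝ := minimalNonneg Q.REquation

noncomputable def U : Matrix (Fin m) (Fin m) ℝ := Q.A0 + Q.R * Q.Adown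

/-- The terms of the series defining `W`. -/
noncomputable def WTerm (j : ℕ) : Matrix (Fin m) (Fin m) ℝ :=
  Q.G ^ j * (Q.U - 1)⁻¹ * Q.R ^ j

noncomputable def W : Matrix (Fin m) (Fin m) ℝ := ∑' j : ℕ, Q.WTerm j

/-- The coefficients of `η(λ) = A_{-1} + (A_0 - I) λ + A_1 λ²`, as complex matrices. -/
noncomputable def eta : Fin 3 → Matrix (Fin m) (Fin m) ℂ :=
  ![Q.Adown.map Complex.ofReal, (Q.A0 - 1).map Complex.ofReal, Q.Aup.map Complex.ofReal]

end QBD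

/-! ### Matrix polynomials and resolvent triples -/

section MatrixPolynomial

variable {n a b : Type*} [Fintype n] [DecidableEq n] [Fintype a] [DecidableEq a]
  [Fintype b] [DecidableEq b] {l : ℕ}

/-- The value at `z` of the matrix polynomial `∑ i : Fin (l + 1), z ^ i • B i`. -/
noncomputable def matPolyEval (B : Fin (l + 1) → Matrix n n ℂ) (z : ℂ) : Matrix n n ℂ :=
  ∑ i : Fin (l + 1), z ^ (i : ℕ) • B i

/-- The matrix with block rows `[X₁ T₁ ^ i | X₂ T₂ ^ (l - 1 - i)]`, `i = 0, …, l - 1`. -/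
def decomposableMatrix (l : ℕ) (X₁ : Matrix n a ℂ) (T₁ : Matrix a a ℂ)
    (X₂ : Matrix n b ℂ) (T₂ : Matrix b b ℂ) : Matrix (Fin l × n) (a ⊕ b) ℂ :=
  Matrix.of fun r =>
    Matrix.fromCols (X₁ * T₁ ^ (r.1 : ℕ)) (X₂ * T₂ ^ (l - 1 - (r.1 : ℕ))) r.2

/-- `([X₁ | X₂], diag(T₁, T₂))` is a decomposable pair for the matrix polynomial of degree `l`
with coefficients `B 0, …, B l`. A two-sided inverse in `nonsingular` exists only if the matrix is
square, that is, if the orders of `T₁` and `T₂` add up to `l` times the order of the `B i`. -/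
structure IsDecomposablePair (B : Fin (l + 1) → Matrix n n ℂ)
    (X₁ : Matrix n a ℂ) (T₁ : Matrix a a ℂ) (X₂ : Matrix n b ℂ) (T₂ : Matrix b b ℂ) : Prop where
  degree : B (Fin.last l) ≠ 0
  nonsingular : ∃ N : Matrix (a ⊕ b) (Fin l × n) ℂ,
    decomposableMatrix l X₁ T₁ X₂ T₂ * N = 1 ∧ N * decomposableMatrix l X₁ T₁ X₂ T₂ = 1
  finite_part : ∑ i : Fin (l + 1), B i * X₁ * T₁ ^ (i : ℕ) = 0
  infinite_part : ∑ i : Fin (l + 1), B i * X₂ * T₂ ^ (l - (i : ℕ)) = 0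

/-- `([X₁ | X₂], diag(T₁, T₂), [Z₁; Z₂])` is a resolvent triple for the matrix polynomial `B`:
the first two entries form a decomposable pair, the determinant of `B(z)` does not vanish
identically, and `B(z)⁻¹ = X T(z)⁻¹ Z` with `T(z) = diag(z I - T₁, z T₂ - I)`, for all `z` at which
`B(z)` is invertible. -/
structure IsResolventTriple (B : Fin (l + 1) → Matrix n n ℂ)
    (X₁ : Matrix n a ℂ) (T₁ : Matrix a a ℂ) (X₂ : Matrix n b ℂ) (T₂ : Matrix b b ℂ)
    (Z₁ : Matrix a n ℂ) (Z₂ : Matrix b n ℂ) : Prop where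
  decomposable : IsDecomposablePair B X₁ T₁ X₂ T₂
  regular : ∃ z : ℂ, IsUnit (matPolyEval B z)
  resolvent : ∀ z : ℂ, IsUnit (matPolyEval B z) →
    IsUnit (Matrix.fromBlocks (z • 1 - T₁) 0 0 (z • T₂ - 1)) ∧
    (matPolyEval B z)⁻¹ =
      Matrix.fromCols X₁ X₂ * (Matrix.fromBlocks (z • 1 - T₁) 0 0 (z • T₂ - 1))⁻¹ *
        Matrix.fromRows Z₁ Z₂

end MatrixPolynomial

open Filter Topology Matrix

/-! Write `T = (I - A₀ - A₁G)⁻¹`. A solution `G` of the first equation splits off a right factor `λI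
- G` from `η(λ)`, and a solution `Ĝ` of the reversed equation splits off a right factor `I - λĜ`. If
`(A₁G + A₀ - I + A₋₁Ĝ) w = I`, the two cofactors combine to `η(λ)⁻¹ = ((λI - G)⁻¹ + (I - λĜ)⁻¹ Ĝ) w`
(`quadratic_inv`). Decomposing `Ĝ` along `M` into `V₁` and `V₀` turns this into the resolvent triple
(`isResolventTriple_of_solvents`), provided that `I - GĜ` is nonsingular, which makes the
decomposable matrix invertible.

What remains is that `w = W` works and that `I - GĜ` is nonsingular. Since `U = A₀ + A₁G`, `W = -N`
with `N = ∑ Gʲ T Rʲ`, the Green matrix of the doubly infinite chain. It satisfies `N = T + G N R`.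
Both `N R` and `Ĝ N` count the expected visits to the level above the initial one, the former by the
last exit from the initial level, the latter by the first entrance (`green_mul_R`). Hence `(I - GĜ)
N = T` with `T` nonsingular, which gives both claims.

Probability enters only through convergence. Reachability of lower levels gives `(A₀ + A₁G)ˢ → 0`,
so `T` exists. For `N` (`summable_green`), in the positive recurrent case mean hitting times form a
Lyapunov function that bounds `∑ Rᵏ`, while the powers of `G` are substochastic. In the transient
case `G` is not stochastic, so `∑ Gᵏ` converges, while the powers of `R` are bounded by means of the
stationary vector of `A₋₁ + A₀ + A₁`. -/

/-! ### Entrywise order on real matrices -/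

/-- The entrywise order on real matrices. -/
def EntryLE {n k : Type*} (A B : Matrix n k ℝ) : Prop := ∀ i j, A i j ≤ B i j

infix:50 " ≤ᵉ " => EntryLE

namespace EntryLE

variable {n k l : Type*} {A B C D : Matrix n k ℝ}

theorem refl (A : Matrix n k ℝ) : A ≤ᵉ A := fun _ _ => le_rfl

theorem trans (h : A ≤ᵉ B) (h' : B ≤ᵉ C) : A ≤ᵉ C := fun i j => (h i j).trans (h' i j)

theorem antisymm (h : A ≤ᵉ B) (h' : B ≤ᵉ A) : A = B := by
  ext i j; exact le_antisymm (h i j) (h' i j)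

theorem add (h : A ≤ᵉ B) (h' : C ≤ᵉ D) : A + C ≤ᵉ B + D :=
  fun i j => add_le_add (h i j) (h' i j)

theorem sub_nonneg : 0 ≤ᵉ B - A ↔ A ≤ᵉ B := by
  simp [EntryLE]

theorem add_nonneg (h : 0 ≤ᵉ A) (h' : 0 ≤ᵉ B) : 0 ≤ᵉ A + B := by
  simpa using h.add h'

theorem one_nonneg [DecidableEq n] : (0 : Matrix n n ℝ) ≤ᵉ 1 := fun i j => by
  rw [Matrix.one_apply]; split_ifs <;> simp

theorem mul_nonneg [Fintype k] {B : Matrix k l ℝ} (hA : 0 ≤ᵉ A) (hB : 0 ≤ᵉ B) : 0 ≤ᵉ A * B :=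
  fun i j => by
    rw [Matrix.mul_apply]
    exact Finset.sum_nonneg fun x _ => _root_.mul_nonneg (hA i x) (hB x j)

theorem mul_left [Fintype k] {B C : Matrix k l ℝ} (hA : 0 ≤ᵉ A) (h : B ≤ᵉ C) :
    A * B ≤ᵉ A * C :=
  fun i j => by
    simp only [Matrix.mul_apply]
    exact Finset.sum_le_sum fun x _ => mul_le_mul_of_nonneg_left (h x j) (hA i x)

theorem mul_right [Fintype k] {C : Matrix k l ℝ} (hC : 0 ≤ᵉ C) (h : A ≤ᵉ B) :
    A * C ≤ᵉ B * C :=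
  fun i j => by
    simp only [Matrix.mul_apply]
    exact Finset.sum_le_sum fun x _ => mul_le_mul_of_nonneg_right (h i x) (hC x j)

theorem mul [Fintype k] {E F : Matrix k l ℝ} (hA : 0 ≤ᵉ A) (hF : 0 ≤ᵉ F) (h : A ≤ᵉ B)
    (h' : E ≤ᵉ F) : A * E ≤ᵉ B * F :=
  (mul_left hA h').trans (mul_right hF h)

theorem pow_nonneg [Fintype n] [DecidableEq n] {A : Matrix n n ℝ} (hA : 0 ≤ᵉ A) (s : ℕ) :
    0 ≤ᵉ A ^ s := by
  induction s with
  | zero => simpa using one_nonneg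
  | succ s ih => rw [pow_succ]; exact mul_nonneg ih hA

theorem pow [Fintype n] [DecidableEq n] {A B : Matrix n n ℝ} (hA : 0 ≤ᵉ A) (h : A ≤ᵉ B) (s : ℕ) :
    A ^ s ≤ᵉ B ^ s := by
  induction s with
  | zero => simpa using refl _
  | succ s ih =>
    rw [pow_succ, pow_succ]
    exact mul (pow_nonneg hA s) (hA.trans h) ih h

theorem mulVec_nonneg [Fintype k] {v : k → ℝ} (hA : 0 ≤ᵉ A) (hv : 0 ≤ v) : 0 ≤ A *ᵥ v :=
  fun i => Finset.sum_nonneg fun j _ => _root_.mul_nonneg (hA i j) (hv j)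

theorem mulVec_left [Fintype k] {v w : k → ℝ} (hA : 0 ≤ᵉ A) (h : v ≤ w) : A *ᵥ v ≤ A *ᵥ w :=
  fun i => Finset.sum_le_sum fun j _ => mul_le_mul_of_nonneg_left (h j) (hA i j)

theorem mulVec_right [Fintype k] {v : k → ℝ} (hv : 0 ≤ v) (h : A ≤ᵉ B) : A *ᵥ v ≤ B *ᵥ v :=
  fun i => Finset.sum_le_sum fun j _ => mul_le_mul_of_nonneg_right (h i j) (hv j)

theorem mulVec [Fintype k] {v w : k → ℝ} (hA : 0 ≤ᵉ A) (hw : 0 ≤ w) (h : A ≤ᵉ B) (h' : v ≤ w) :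
    A *ᵥ v ≤ B *ᵥ w :=
  (mulVec_left hA h').trans (mulVec_right hw h)

theorem vecMul_mono [Fintype n] {v w : n → ℝ} (hA : 0 ≤ᵉ A) (h : v ≤ w) : v ᵥ* A ≤ w ᵥ* A :=
  fun j => Finset.sum_le_sum fun i _ => mul_le_mul_of_nonneg_right (h i) (hA i j)

theorem of_tendsto {f g : ℕ → Matrix n k ℝ} (hf : Tendsto f atTop (𝓝 A))
    (hg : Tendsto g atTop (𝓝 B)) (h : ∀ s, f s ≤ᵉ g s) : A ≤ᵉ B := fun i j =>
  le_of_tendsto_of_tendsto' ((tendsto_pi_nhds.1 ((tendsto_pi_nhds.1 hf) i)) j)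
    ((tendsto_pi_nhds.1 ((tendsto_pi_nhds.1 hg) i)) j) fun s => h s i j

end EntryLE

open EntryLE

theorem tendsto_matrix_iff {n k : Type*} {f : ℕ → Matrix n k ℝ} {A : Matrix n k ℝ} :
    Tendsto f atTop (𝓝 A) ↔ ∀ i j, Tendsto (fun s => f s i j) atTop (𝓝 (A i j)) := by
  constructor
  · intro hf i j
    exact (tendsto_pi_nhds.1 ((tendsto_pi_nhds.1 hf) i)) j
  · intro hf
    exact tendsto_pi_nhds.2 fun i => tendsto_pi_nhds.2 fun j => hf i j

/-! ### Minimal nonnegative solutions by monotone iteration -/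

section MonotoneIteration

variable {n : Type*}

/-- The iterates of `f` from `0` increase, stay in `C` and hence below `Y`, so they converge. The
last clause is an induction principle: a closed property that holds at `0` and is preserved by `f`
passes to the limit. -/
theorem exists_minimal_fixedPoint (f : Matrix n n ℝ → Matrix n n ℝ) (hf : Continuous f)
    (hmono : ∀ X Y, 0 ≤ᵉ X → X ≤ᵉ Y → f X ≤ᵉ f Y) (h0 : 0 ≤ᵉ f 0)
    (C : Set (Matrix n n ℝ)) (hC0 : 0 ∈ C) (hC : ∀ X, 0 ≤ᵉ X → X ∈ C → f X ∈ C)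
    (Y : Matrix n n ℝ) (hY : ∀ X ∈ C, X ≤ᵉ Y) :
    ∃ X, 0 ≤ᵉ X ∧ f X = X ∧ (∀ Z, 0 ≤ᵉ Z → f Z ≤ᵉ Z → X ≤ᵉ Z) ∧
      ∀ D : Set (Matrix n n ℝ), IsClosed D → 0 ∈ D → (∀ Z, 0 ≤ᵉ Z → Z ∈ D → f Z ∈ D) → X ∈ D := by
  have hnn : ∀ s, 0 ≤ᵉ f^[s] 0 := by
    intro s
    induction s with
    | zero => exact refl _
    | succ s ih =>
      rw [Function.iterate_succ_apply']
      exact h0.trans (hmono _ _ (refl _) ih)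
  have hmem : ∀ D : Set (Matrix n n ℝ), 0 ∈ D → (∀ Z, 0 ≤ᵉ Z → Z ∈ D → f Z ∈ D) →
      ∀ s, f^[s] 0 ∈ D := by
    intro D hD0 hD s
    induction s with
    | zero => exact hD0
    | succ s ih =>
      rw [Function.iterate_succ_apply']
      exact hD _ (hnn s) ih
  have hstep : ∀ s, f^[s] 0 ≤ᵉ f^[s + 1] 0 := by
    intro s
    induction s with
    | zero => simpa using h0
    | succ s ih =>
      rw [Function.iterate_succ_apply', Function.iterate_succ_apply']
      rw [Function.iterate_succ_apply'] at ih ⊢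
      exact hmono _ _ (hnn s) ih
  have hlim : ∀ i j, ∃ x, Tendsto (fun s => f^[s] 0 i j) atTop (𝓝 x) := by
    intro i j
    have hm : Monotone fun s => f^[s] 0 i j := monotone_nat_of_le_succ fun s => hstep s i j
    exact ⟨_, tendsto_atTop_ciSup hm
      ⟨Y i j, by rintro _ ⟨s, rfl⟩; exact hY _ (hmem C hC0 hC s) i j⟩⟩
  choose x hx using hlim
  have hX : Tendsto (fun s => f^[s] 0) atTop (𝓝 (Matrix.of x)) := tendsto_matrix_iff.2 hx
  refine ⟨Matrix.of x, of_tendsto tendsto_const_nhds hX hnn, ?_, ?_, ?_⟩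
  · have h1 := (hf.tendsto _).comp hX
    have h2 := (tendsto_add_atTop_iff_nat 1).2 hX
    refine tendsto_nhds_unique h1 (h2.congr fun s => ?_)
    rw [Function.iterate_succ_apply']; rfl
  · intro Z hZ hfZ
    exact of_tendsto hX tendsto_const_nhds
      (hmem {X | X ≤ᵉ Z} hZ fun X hX0 hXZ => (hmono _ _ hX0 hXZ).trans hfZ)
  · intro D hD hD0 hDf
    exact hD.mem_of_tendsto hX (Eventually.of_forall (hmem D hD0 hDf))

theorem EntryLE.isClosed_setOf {k : Type*} {f g : Matrix n n ℝ → Matrix n k ℝ} (hf : Continuous f)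
    (hg : Continuous g) : IsClosed {X | f X ≤ᵉ g X} := by
  simp only [EntryLE, Set.ofPred_forall]
  exact isClosed_iInter fun i => isClosed_iInter fun j =>
    isClosed_le (hf.matrix_elem i j) (hg.matrix_elem i j)

end MonotoneIteration

theorem IsMinimalNonneg.unique {m : ℕ} {p : Matrix (Fin m) (Fin m) ℝ → Prop}
    {X Y : Matrix (Fin m) (Fin m) ℝ} (hX : IsMinimalNonneg p X) (hY : IsMinimalNonneg p Y) :
    X = Y :=
  EntryLE.antisymm (hX.2.2 Y hY.1 hY.2.1) (hY.2.2 X hX.1 hX.2.1)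

theorem minimalNonneg_eq {m : ℕ} {p : Matrix (Fin m) (Fin m) ℝ → Prop}
    {X : Matrix (Fin m) (Fin m) ℝ} (hX : IsMinimalNonneg p X) : minimalNonneg p = X := by
  have h : ∃ X, IsMinimalNonneg p X := ⟨X, hX⟩
  rw [minimalNonneg, dif_pos h]
  exact h.choose_spec.unique hX

/-! ### Nonnegative matrices whose powers tend to zero -/

section PowTendstoZero

variable {n : Type*} [Fintype n] [DecidableEq n] {S : Matrix n n ℝ}

theorem isUnit_one_sub_of_tendsto (h : Tendsto (fun s => S ^ s) atTop (𝓝 0)) :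
    IsUnit (1 - S) := by
  rw [Matrix.isUnit_iff_isUnit_det, isUnit_iff_ne_zero]
  intro hdet
  obtain ⟨v, hv, h0⟩ := Matrix.exists_mulVec_eq_zero_iff.2 hdet
  have hS : S *ᵥ v = v := by
    rw [Matrix.sub_mulVec, Matrix.one_mulVec, sub_eq_zero] at h0
    exact h0.symm
  have hpow : ∀ s, S ^ s *ᵥ v = v := by
    intro s
    induction s with
    | zero => simp
    | succ s ih => rw [pow_succ, ← Matrix.mulVec_mulVec, hS, ih]
  have hc : Continuous fun A : Matrix n n ℝ => A *ᵥ v :=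
    continuous_id.matrix_mulVec continuous_const
  have h1 := (hc.tendsto 0).comp h
  simp only [Function.comp_def, hpow, Matrix.zero_mulVec] at h1
  exact hv (tendsto_nhds_unique tendsto_const_nhds h1)

theorem hasSum_pow_of_tendsto (hS : 0 ≤ᵉ S) (h : Tendsto (fun s => S ^ s) atTop (𝓝 0)) (i j : n) :
    HasSum (fun s => (S ^ s) i j) ((1 - S)⁻¹ i j) := by
  have hu := isUnit_one_sub_of_tendsto h
  have hdet := (Matrix.isUnit_iff_isUnit_det _).1 hu
  have hsum : ∀ s, ∑ k ∈ Finset.range s, S ^ k = (1 - S)⁻¹ * (1 - S ^ s) := by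
    intro s
    rw [← mul_neg_geom_sum S s, ← Matrix.mul_assoc, Matrix.nonsing_inv_mul _ hdet, Matrix.one_mul]
  have hc : Continuous fun A : Matrix n n ℝ => (1 - S)⁻¹ * (1 - A) :=
    continuous_const.matrix_mul (continuous_const.sub continuous_id)
  have h1 := (hc.tendsto 0).comp h
  simp only [Function.comp_def, ← hsum, sub_zero, Matrix.mul_one] at h1
  rw [hasSum_iff_tendsto_nat_of_nonneg (fun s => pow_nonneg hS s i j)]
  refine (tendsto_matrix_iff.1 h1 i j).congr fun s => ?_
  rw [Matrix.sum_apply]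

theorem inv_one_sub_nonneg (hS : 0 ≤ᵉ S) (h : Tendsto (fun s => S ^ s) atTop (𝓝 0)) :
    0 ≤ᵉ (1 - S)⁻¹ := fun i j =>
  (hasSum_pow_of_tendsto hS h i j).nonneg fun s => pow_nonneg hS s i j

theorem tendsto_pow_of_le {T : Matrix n n ℝ} (hT : 0 ≤ᵉ T) (hTS : T ≤ᵉ S)
    (h : Tendsto (fun s => S ^ s) atTop (𝓝 0)) : Tendsto (fun s => T ^ s) atTop (𝓝 0) := by
  rw [tendsto_matrix_iff] at h ⊢
  intro i j
  exact squeeze_zero (fun s => pow_nonneg hT s i j) (fun s => EntryLE.pow hT hTS s i j) (h i j)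

/-- The vectors `S ^ s *ᵥ 1` decrease to a fixed vector of `S` between `0` and `1`, which `hfix`
forces to vanish; they are the row sums of the powers. -/
theorem tendsto_pow_of_substochastic (hS : 0 ≤ᵉ S) (h1 : S *ᵥ 1 ≤ 1)
    (hfix : ∀ u : n → ℝ, 0 ≤ u → u ≤ 1 → S *ᵥ u = u → u = 0) :
    Tendsto (fun s => S ^ s) atTop (𝓝 0) := by
  have hnn : ∀ s, 0 ≤ S ^ s *ᵥ (1 : n → ℝ) := fun s =>
    mulVec_nonneg (pow_nonneg hS s) zero_le_one
  have hstep : ∀ s, S ^ (s + 1) *ᵥ (1 : n → ℝ) ≤ S ^ s *ᵥ 1 := by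
    intro s
    rw [pow_succ, ← Matrix.mulVec_mulVec]
    exact mulVec_left (pow_nonneg hS s) h1
  have hanti : Antitone fun s => S ^ s *ᵥ (1 : n → ℝ) := antitone_nat_of_succ_le hstep
  have hlim : ∀ i, ∃ x, Tendsto (fun s => (S ^ s *ᵥ (1 : n → ℝ)) i) atTop (𝓝 x) := fun i =>
    ⟨_, tendsto_atTop_ciInf (fun a b hab => hanti hab i)
      ⟨0, by rintro _ ⟨s, rfl⟩; exact hnn s i⟩⟩
  choose u hu using hlim
  have hU : Tendsto (fun s => S ^ s *ᵥ (1 : n → ℝ)) atTop (𝓝 u) := tendsto_pi_nhds.2 hu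
  have hu0 : u = 0 := by
    refine hfix u (ge_of_tendsto' hU hnn) (le_of_tendsto' hU fun s => ?_) ?_
    · simpa using hanti (Nat.zero_le s)
    · have hc : Continuous fun v : n → ℝ => S *ᵥ v := continuous_const.matrix_mulVec continuous_id
      refine tendsto_nhds_unique ((hc.tendsto u).comp hU)
        (((tendsto_add_atTop_iff_nat 1).2 hU).congr fun s => ?_)
      simp only [Function.comp_def]
      rw [pow_succ', ← Matrix.mulVec_mulVec]
  rw [tendsto_matrix_iff]
  intro i j
  refine squeeze_zero (fun s => pow_nonneg hS s i j) (fun s => ?_) (by simpa [hu0] using hu i)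
  have : (S ^ s *ᵥ (1 : n → ℝ)) i = ∑ k, (S ^ s) i k := by simp [Matrix.mulVec, dotProduct]
  rw [this]
  exact Finset.single_le_sum (f := fun k => (S ^ s) i k) (fun k _ => pow_nonneg hS s i k)
    (Finset.mem_univ j)

end PowTendstoZero

/-! ### Summability of products with one summable and one bounded factor -/

section Summable

variable {n : Type*} [Fintype n]

theorem summable_mul_mul_left {X Y : ℕ → Matrix n n ℝ} {N : Matrix n n ℝ} {C : ℝ}
    (hX : ∀ i j, Summable fun s => X s i j) (hX0 : ∀ s, 0 ≤ᵉ X s) (hN : 0 ≤ᵉ N)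
    (hY0 : ∀ s, 0 ≤ᵉ Y s) (hY : ∀ s i j, Y s i j ≤ C) :
    Summable fun s => X s * N * Y s := by
  refine Pi.summable.2 fun i => Pi.summable.2 fun j => ?_
  simp only [Matrix.mul_apply, Finset.sum_mul]
  refine summable_sum fun b _ => summable_sum fun a _ => ?_
  refine Summable.of_nonneg_of_le (fun s => ?_) (fun s => ?_)
    (((hX i a).mul_right (N a b)).mul_right C)
  · exact _root_.mul_nonneg (_root_.mul_nonneg (hX0 s i a) (hN a b)) (hY0 s b j)
  · exact mul_le_mul_of_nonneg_left (hY s b j) (_root_.mul_nonneg (hX0 s i a) (hN a b))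

theorem summable_mul_mul_right {X Y : ℕ → Matrix n n ℝ} {N : Matrix n n ℝ} {C : ℝ}
    (hX0 : ∀ s, 0 ≤ᵉ X s) (hX : ∀ s i j, X s i j ≤ C) (hN : 0 ≤ᵉ N)
    (hY0 : ∀ s, 0 ≤ᵉ Y s) (hY : ∀ i j, Summable fun s => Y s i j) :
    Summable fun s => X s * N * Y s := by
  have h := summable_mul_mul_left (X := fun s => (Y s)ᵀ) (Y := fun s => (X s)ᵀ) (N := Nᵀ) (C := C)
    (fun i j => hY j i) (fun s i j => hY0 s j i) (fun i j => hN j i) (fun s i j => hX0 s j i)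
    (fun s i j => hX s j i)
  have h2 := h.matrix_transpose
  simpa [Matrix.transpose_mul, Matrix.mul_assoc] using h2

end Summable
open EntryLE

namespace QBD

variable {m : ℕ} (Q : QBD m)

/-! ### The minimal solution `G` -/

/-- The QBD with the two directions interchanged. -/
def rev : QBD m where
  -- The boundary block does not enter `G`; this choice only makes the row sums of level `0` equal
  -- to one.
  B := Q.A0 + Q.Aup
  Adown := Q.Aup
  A0 := Q.A0
  Aup := Q.Adown
  B_nonneg i j := _root_.add_nonneg (Q.A0_nonneg i j) (Q.Aup_nonneg i j)
  Adown_nonneg := Q.Aup_nonneg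
  A0_nonneg := Q.A0_nonneg
  Aup_nonneg := Q.Adown_nonneg
  boundary_row_sum i := by
    rw [← Q.interior_row_sum i]
    exact Finset.sum_congr rfl fun j _ => by rw [Matrix.add_apply]; ring
  interior_row_sum i := by
    rw [← Q.interior_row_sum i]
    exact Finset.sum_congr rfl fun j _ => by ring

theorem row_sum : Q.Adown *ᵥ 1 + Q.A0 *ᵥ 1 + Q.Aup *ᵥ 1 = 1 := by
  ext i
  simpa [Matrix.mulVec, dotProduct, Finset.sum_add_distrib] using Q.interior_row_sum i

/-- The map whose fixed points are the solutions of the equation for `G`. -/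
def GMap (X : Matrix (Fin m) (Fin m) ℝ) : Matrix (Fin m) (Fin m) ℝ :=
  Q.Adown + Q.A0 * X + Q.Aup * X * X

theorem GEquation_iff (X : Matrix (Fin m) (Fin m) ℝ) : Q.GEquation X ↔ Q.GMap X = X := by
  rw [GEquation, GMap, ← sub_eq_zero (b := X)]
  refine Eq.congr ?_ rfl
  noncomm_ring

theorem GMap_mono {X Y : Matrix (Fin m) (Fin m) ℝ} (hX : 0 ≤ᵉ X) (h : X ≤ᵉ Y) :
    Q.GMap X ≤ᵉ Q.GMap Y :=
  ((EntryLE.refl _).add (mul_left Q.A0_nonneg h)).add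
    (mul (mul_nonneg Q.Aup_nonneg hX) (hX.trans h) (mul_left Q.Aup_nonneg h) h)

theorem continuous_GMap : Continuous Q.GMap :=
  (continuous_const.add (continuous_const.matrix_mul continuous_id)).add
    ((continuous_const.matrix_mul continuous_id).matrix_mul continuous_id)

theorem GMap_mulVec_one {X : Matrix (Fin m) (Fin m) ℝ} (hX : 0 ≤ᵉ X) (h : X *ᵥ 1 ≤ 1) :
    Q.GMap X *ᵥ 1 ≤ 1 := by
  have h1 : X *ᵥ X *ᵥ 1 ≤ (1 : Fin m → ℝ) := (mulVec_left hX h).trans h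
  have e : Q.GMap X *ᵥ 1 = Q.Adown *ᵥ 1 + Q.A0 *ᵥ X *ᵥ 1 + Q.Aup *ᵥ X *ᵥ X *ᵥ 1 := by
    simp only [GMap, Matrix.add_mulVec, Matrix.mulVec_mulVec, Matrix.mul_assoc]
  rw [e]
  exact (add_le_add (add_le_add le_rfl (mulVec_left Q.A0_nonneg h))
    (mulVec_left Q.Aup_nonneg h1)).trans_eq Q.row_sum

theorem exists_G : ∃ X, 0 ≤ᵉ X ∧ Q.GMap X = X ∧ (∀ Z, 0 ≤ᵉ Z → Q.GMap Z ≤ᵉ Z → X ≤ᵉ Z) ∧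
    ∀ D : Set (Matrix (Fin m) (Fin m) ℝ), IsClosed D → 0 ∈ D →
      (∀ Z, 0 ≤ᵉ Z → Z ∈ D → Q.GMap Z ∈ D) → X ∈ D := by
  refine exists_minimal_fixedPoint Q.GMap Q.continuous_GMap (fun X Y => Q.GMap_mono)
    (by rw [GMap]; simpa using! Q.Adown_nonneg) {X | 0 ≤ᵉ X ∧ X *ᵥ 1 ≤ 1} ⟨EntryLE.refl _, ?_⟩
    (fun X _ hX => ⟨?_, Q.GMap_mulVec_one hX.1 hX.2⟩) (Matrix.of fun _ _ => 1) ?_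
  · simp
  · exact (add_nonneg (add_nonneg Q.Adown_nonneg (mul_nonneg Q.A0_nonneg hX.1))
      (mul_nonneg (mul_nonneg Q.Aup_nonneg hX.1) hX.1))
  · rintro X ⟨hX, h1⟩ i j
    have : (X *ᵥ (1 : Fin m → ℝ)) i = ∑ k, X i k := by simp [Matrix.mulVec, dotProduct]
    refine le_trans ?_ (this ▸ h1 i)
    exact Finset.single_le_sum (f := fun k => X i k) (fun k _ => hX i k) (Finset.mem_univ j)

theorem isMinimal_G : IsMinimalNonneg Q.GEquation Q.G := by
  obtain ⟨X, h0, hX, hmin, -⟩ := Q.exists_G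
  have h : IsMinimalNonneg Q.GEquation X :=
    ⟨h0, (Q.GEquation_iff X).2 hX, fun Y hY hYe =>
      hmin Y hY (((Q.GEquation_iff Y).1 hYe).symm ▸ EntryLE.refl _)⟩
  rw [G, minimalNonneg_eq h]
  exact h

theorem G_nonneg : 0 ≤ᵉ Q.G := Q.isMinimal_G.1

theorem GMap_G : Q.GMap Q.G = Q.G := (Q.GEquation_iff _).1 Q.isMinimal_G.2.1

theorem G_induction (D : Set (Matrix (Fin m) (Fin m) ℝ)) (hD : IsClosed D) (h0 : 0 ∈ D)
    (hstep : ∀ Z, 0 ≤ᵉ Z → Z ∈ D → Q.GMap Z ∈ D) : Q.G ∈ D := by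
  obtain ⟨X, hX0, hX, hmin, hind⟩ := Q.exists_G
  have h : IsMinimalNonneg Q.GEquation X :=
    ⟨hX0, (Q.GEquation_iff X).2 hX, fun Y hY hYe =>
      hmin Y hY (((Q.GEquation_iff Y).1 hYe).symm ▸ EntryLE.refl _)⟩
  rw [G, minimalNonneg_eq h]
  exact hind D hD h0 hstep

theorem G_mulVec_one : Q.G *ᵥ 1 ≤ 1 :=
  Q.G_induction {X | X *ᵥ 1 ≤ 1}
    (isClosed_le (continuous_id.matrix_mulVec continuous_const) continuous_const)
    (by simp) fun _ hX h => Q.GMap_mulVec_one hX h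

/-- Interchanging up and down turns the equation for `G` into the one for `Ghat` definitionally, so
every fact about `G` transfers through `rev`. -/
theorem isMinimal_Ghat : IsMinimalNonneg Q.GhatEquation Q.Ghat := Q.rev.isMinimal_G

/-! ### The kernel of the excursions above a level -/

/-- The substochastic kernel of the first return to a level from above. -/
noncomputable def excursion : Matrix (Fin m) (Fin m) ℝ := Q.A0 + Q.Aup * Q.G

theorem excursion_nonneg : 0 ≤ᵉ Q.excursion :=
  add_nonneg Q.A0_nonneg (mul_nonneg Q.Aup_nonneg Q.G_nonneg)

theorem excursion_mulVec_one : Q.excursion *ᵥ 1 ≤ 1 := by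
  have h1 : Q.Aup *ᵥ Q.G *ᵥ 1 ≤ Q.Aup *ᵥ 1 := mulVec_left Q.Aup_nonneg Q.G_mulVec_one
  have h2 : 0 ≤ Q.Adown *ᵥ (1 : Fin m → ℝ) := mulVec_nonneg Q.Adown_nonneg zero_le_one
  rw [excursion, Matrix.add_mulVec, ← Matrix.mulVec_mulVec]
  intro i
  have h3 := congrFun Q.row_sum i
  have := h1 i
  have := h2 i
  simp only [Pi.add_apply, Pi.zero_apply] at *
  linarith

theorem G_eq : Q.G = Q.Adown + Q.excursion * Q.G := by
  conv_lhs => rw [← Q.GMap_G]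
  rw [GMap, excursion]
  noncomm_ring

theorem mulVec_apply_eq_of_le {n : Type*} [Fintype n] {A : Matrix n n ℝ} {v : n → ℝ} {c : ℝ}
    (hA : 0 ≤ᵉ A) (hv : ∀ j, v j ≤ c) {i : n} (h : (A *ᵥ v) i = c * ∑ j, A i j) {j : n}
    (hij : 0 < A i j) : v j = c := by
  have h1 : ∑ k, A i k * (c - v k) = 0 := by
    simp only [mul_sub, Finset.sum_sub_distrib, ← Finset.sum_mul]
    simp only [Matrix.mulVec, dotProduct] at h
    rw [h]; ring
  have h2 := (Finset.sum_eq_zero_iff_of_nonneg fun k _ =>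
    _root_.mul_nonneg (hA i k) (sub_nonneg.2 (hv k))).1 h1 j (Finset.mem_univ j)
  rcases mul_eq_zero.1 h2 with h3 | h3
  · exact absurd h3 hij.ne'
  · linarith

/-- From every state of level `0` the doubly infinite chain can get below level `0`. -/
def ReachesBelow : Prop :=
  ∀ i, ∃ t : ℤ × Fin m, t.1 < 0 ∧ Reaches Q.doublyInfinite (0, i) t

/-- Maximum principle: a nonzero fixed vector `u` of the kernel extends to a bounded harmonic
function on the levels `n ≥ 0` for the chain killed below level `0`. The states where it attains its
maximum are closed under transitions and allow no step below level `0`, against `ReachesBelow`. -/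
theorem tendsto_excursion_pow (h : Q.ReachesBelow) :
    Tendsto (fun s => Q.excursion ^ s) atTop (𝓝 0) := by
  refine tendsto_pow_of_substochastic Q.excursion_nonneg Q.excursion_mulVec_one ?_
  intro u hu0 hu1 hfix
  by_contra hne
  obtain ⟨i₁, hi₁⟩ := Function.ne_iff.1 hne
  obtain ⟨i₀, -, hmax⟩ := Finset.exists_max_image Finset.univ u ⟨i₁, Finset.mem_univ _⟩
  have hmax : ∀ i, u i ≤ u i₀ := fun i => hmax i (Finset.mem_univ i)
  set c := u i₀ with hc
  have hcpos : 0 < c := lt_of_lt_of_le (lt_of_le_of_ne (hu0 i₁) (Ne.symm hi₁)) (hmax i₁)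
  -- The harmonic extension: from level `n` the chain must pass down `n` levels before `u` is
  -- evaluated at level `0`.
  set φ : ℕ → Fin m → ℝ := fun n => Q.G ^ n *ᵥ u with hφ
  have hGpow : ∀ n, φ n ≤ fun _ => c := by
    intro n
    induction n with
    | zero => intro i; simpa [hφ] using hmax i
    | succ n ih =>
      have e : φ (n + 1) = Q.G *ᵥ φ n := by simp only [hφ, pow_succ', Matrix.mulVec_mulVec]
      have e2 : (fun _ => c : Fin m → ℝ) = c • 1 := by ext; simp
      rw [e]
      refine (mulVec_left Q.G_nonneg ih).trans ?_
      rw [e2, Matrix.mulVec_smul]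
      exact smul_le_smul_of_nonneg_left Q.G_mulVec_one hcpos.le
  have hφ0 : φ 0 = Q.A0 *ᵥ φ 0 + Q.Aup *ᵥ φ 1 := by
    have : φ 0 = Q.excursion *ᵥ u := by simp [hφ, hfix]
    conv_lhs => rw [this]
    simp [hφ, excursion, Matrix.add_mulVec, Matrix.mulVec_mulVec]
  have hφS : ∀ n, φ (n + 1) = Q.Adown *ᵥ φ n + Q.A0 *ᵥ φ (n + 1) + Q.Aup *ᵥ φ (n + 2) := by
    intro n
    have e : Q.G ^ (n + 1) =
        Q.Adown * Q.G ^ n + Q.A0 * Q.G ^ (n + 1) + Q.Aup * Q.G ^ (n + 2) := by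
      have h1 := congrArg (· * Q.G ^ n) Q.GMap_G
      simp only [GMap, add_mul, Matrix.mul_assoc] at h1
      simp only [pow_succ' Q.G]
      exact h1.symm
    simp only [hφ]
    conv_lhs => rw [e]
    simp only [Matrix.add_mulVec, Matrix.mulVec_mulVec]
  have hrow := Q.interior_row_sum
  have hle : ∀ (A : Matrix (Fin m) (Fin m) ℝ) (_ : 0 ≤ᵉ A) n i, (A *ᵥ φ n) i ≤ c * ∑ j, A i j := by
    intro A hA n i
    rw [mul_comm, Finset.sum_mul, Matrix.mulVec, dotProduct]
    exact Finset.sum_le_sum fun j _ => mul_le_mul_of_nonneg_left (hGpow n j) (hA i j)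
  have hclosed : ∀ s t : ℤ × Fin m, 0 < Q.doublyInfinite s t → 0 ≤ s.1 → φ s.1.toNat s.2 = c →
      0 ≤ t.1 ∧ φ t.1.toNat t.2 = c := by
    rintro ⟨z, i⟩ ⟨w, j⟩ hpos hz hzi
    obtain ⟨n, rfl⟩ := Int.eq_ofNat_of_zero_le hz
    simp only [Int.toNat_natCast] at hzi
    simp only [doublyInfinite] at hpos
    have hri := hrow i
    rw [Finset.sum_add_distrib, Finset.sum_add_distrib] at hri
    replace hri := congrArg (c * ·) hri
    simp only [mul_add, mul_one] at hri
    have hA0 := hle Q.A0 Q.A0_nonneg n i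
    have hA1 := hle Q.Aup Q.Aup_nonneg (n + 1) i
    -- The value `0` for `n = 0` reflects the killing below level `0`.
    have hdown : c * ∑ j, Q.Adown i j ≤ Nat.casesOn n 0 fun k => (Q.Adown *ᵥ φ k) i := by
      cases n with
      | zero =>
        have := congrFun hφ0 i
        simp only [Pi.add_apply, zero_add] at this hA1
        change _ ≤ (0 : ℝ)
        linarith
      | succ n =>
        have := congrFun (hφS n) i
        simp only [Pi.add_apply] at this hA1
        linarith
    have hup : (Q.Aup *ᵥ φ (n + 1)) i = c * ∑ j, Q.Aup i j ∧
        (Q.A0 *ᵥ φ n) i = c * ∑ j, Q.A0 i j := by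
      cases n with
      | zero =>
        have h1 := congrFun hφ0 i
        have h2 : 0 ≤ c * ∑ j, Q.Adown i j :=
          _root_.mul_nonneg hcpos.le (Finset.sum_nonneg fun j _ => Q.Adown_nonneg i j)
        simp only [Pi.add_apply, zero_add] at h1 hA1 ⊢
        constructor <;> linarith
      | succ n =>
        have h1 := congrFun (hφS n) i
        have h2 := hle Q.Adown Q.Adown_nonneg n i
        simp only [Pi.add_apply] at h1 hA1 ⊢
        constructor <;> linarith
    by_cases h1 : w = (n : ℤ) + 1
    · rw [if_pos h1] at hpos
      subst h1
      refine ⟨by positivity, ?_⟩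
      exact mulVec_apply_eq_of_le Q.Aup_nonneg (fun j => hGpow (n + 1) j) hup.1 hpos
    rw [if_neg h1] at hpos
    by_cases h2 : w = (n : ℤ)
    · rw [if_pos h2] at hpos
      subst h2
      refine ⟨hz, ?_⟩
      exact mulVec_apply_eq_of_le Q.A0_nonneg (fun j => hGpow n j) hup.2 hpos
    rw [if_neg h2] at hpos
    by_cases h3 : w = (n : ℤ) - 1
    · rw [if_pos h3] at hpos
      cases n with
      | zero =>
        exfalso
        have h4 : 0 < ∑ j, Q.Adown i j :=
          Finset.sum_pos' (fun j _ => Q.Adown_nonneg i j) ⟨j, Finset.mem_univ j, hpos⟩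
        have := mul_pos hcpos h4
        change _ ≤ (0 : ℝ) at hdown
        linarith
      | succ n =>
        have hw : w = (n : ℤ) := by push_cast at h3; omega
        subst hw
        refine ⟨by positivity, ?_⟩
        exact mulVec_apply_eq_of_le Q.Adown_nonneg (fun j => hGpow n j)
          (le_antisymm (hle Q.Adown Q.Adown_nonneg n i) hdown) hpos
    · rw [if_neg h3] at hpos
      exact absurd hpos (lt_irrefl 0)
  obtain ⟨t, ht, hreach⟩ := h i₀
  have key : ∀ t, Reaches Q.doublyInfinite (0, i₀) t → 0 ≤ t.1 ∧ φ t.1.toNat t.2 = c := by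
    intro t ht
    induction ht with
    | refl => simp [hφ, hc]
    | tail _ hst ih => exact hclosed _ _ hst ih.1 ih.2
  have := (key t hreach).1
  omega

end QBD
open EntryLE

/-! ### Stationary vectors -/

section Stationary

variable {n : Type*} [Fintype n] [DecidableEq n]

/-- For a left eigenvector `v` at eigenvalue `1`, the triangle inequality gives `|v| ≤ |v| A`
entrywise. Both sides have the same total mass because `A` is stochastic, so they agree;
irreducibility then makes `|v|` positive. -/
theorem Matrix.IsIrreducible.exists_stationary [Nonempty n] {A : Matrix n n ℝ}
    (hA : A.IsIrreducible) (h1 : A *ᵥ 1 = 1) : ∃ π : n → ℝ, (∀ i, 0 < π i) ∧ π ᵥ* A = π := by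
  have hdet : (1 - A).det = 0 :=
    Matrix.exists_mulVec_eq_zero_iff.1 ⟨1, one_ne_zero, by simp [Matrix.sub_mulVec, h1]⟩
  obtain ⟨v, hv, h0⟩ := Matrix.exists_vecMul_eq_zero_iff.2 hdet
  have hvA : v ᵥ* A = v := by
    rw [Matrix.vecMul_sub, Matrix.vecMul_one, sub_eq_zero] at h0
    exact h0.symm
  set π : n → ℝ := fun i => |v i| with hπ
  have hle : ∀ j, π j ≤ (π ᵥ* A) j := by
    intro j
    simp only [hπ]
    conv_lhs => rw [← hvA]
    refine (Finset.abs_sum_le_sum_abs _ _).trans_eq (Finset.sum_congr rfl fun i _ => ?_)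
    rw [abs_mul, abs_of_nonneg (hA.nonneg i j)]
  have hsum : ∑ j, (π ᵥ* A) j = ∑ j, π j := by
    have h2 : ∀ i, ∑ j, A i j = 1 := fun i => by
      simpa [Matrix.mulVec, dotProduct] using congrFun h1 i
    simp only [Matrix.vecMul, dotProduct]
    rw [Finset.sum_comm]
    simp only [← Finset.mul_sum, h2, mul_one]
  have hst : π ᵥ* A = π := by
    ext j
    exact (((Finset.sum_eq_sum_iff_of_le fun j _ => hle j).1 hsum.symm) j (Finset.mem_univ j)).symm
  have hpow : ∀ k, π ᵥ* A ^ k = π := by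
    intro k
    induction k with
    | zero => simp
    | succ k ih => rw [pow_succ, ← Matrix.vecMul_vecMul, ih, hst]
  refine ⟨π, fun j => ?_, hst⟩
  obtain ⟨i, hi⟩ := Function.ne_iff.1 hv
  obtain ⟨k, -, hk⟩ := (Matrix.isIrreducible_iff_exists_pow_pos hA.nonneg).1 hA i j
  rw [← hpow k]
  refine lt_of_lt_of_le (mul_pos (abs_pos.2 hi) hk) ?_
  exact Finset.single_le_sum (f := fun i => π i * (A ^ k) i j)
    (fun i _ => _root_.mul_nonneg (abs_nonneg _) (pow_nonneg hA.nonneg k i j)) (Finset.mem_univ i)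

/-- A single term of `(π Aᵏ)ⱼ ≤ πⱼ` gives `(Aᵏ)ᵢⱼ ≤ πⱼ / πᵢ`; the sum of these ratios is a uniform
bound. -/
theorem exists_bound_of_vecMul_le {A : Matrix n n ℝ} (hA : 0 ≤ᵉ A) {π : n → ℝ} (hπ : ∀ i, 0 < π i)
    (h : π ᵥ* A ≤ π) : ∃ C, ∀ k i j, (A ^ k) i j ≤ C := by
  have hpow : ∀ k, π ᵥ* A ^ k ≤ π := by
    intro k
    induction k with
    | zero => simp
    | succ k ih =>
      rw [pow_succ, ← Matrix.vecMul_vecMul]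
      exact (EntryLE.vecMul_mono hA ih).trans h
  refine ⟨∑ i, ∑ j, π j / π i, fun k i j => ?_⟩
  have h1 : π i * (A ^ k) i j ≤ π j := by
    refine le_trans ?_ (hpow k j)
    exact Finset.single_le_sum (f := fun i => π i * (A ^ k) i j)
      (fun i _ => _root_.mul_nonneg (hπ i).le (pow_nonneg hA k i j)) (Finset.mem_univ i)
  have h2 : (A ^ k) i j ≤ π j / π i := by rw [le_div_iff₀ (hπ i)]; linarith
  refine h2.trans ?_
  have hnn : ∀ i j, 0 ≤ π j / π i := fun i j => div_nonneg (hπ j).le (hπ i).le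
  exact (Finset.single_le_sum (f := fun j => π j / π i) (fun j _ => hnn i j)
    (Finset.mem_univ j)).trans (Finset.single_le_sum (f := fun i => ∑ j, π j / π i)
      (fun i _ => Finset.sum_nonneg fun j _ => hnn i j) (Finset.mem_univ i))

end Stationary

namespace QBD

variable {m : ℕ} {Q : QBD m}

/-! ### The minimal solution `R` -/

/-- The expected numbers of visits to a level before the first passage below it. -/
noncomputable def tabooGreen (Q : QBD m) : Matrix (Fin m) (Fin m) ℝ := (1 - Q.excursion)⁻¹

theorem isUnit_one_sub_excursion (h : Q.ReachesBelow) : IsUnit (1 - Q.excursion) :=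
  isUnit_one_sub_of_tendsto (Q.tendsto_excursion_pow h)

theorem tabooGreen_nonneg (h : Q.ReachesBelow) : 0 ≤ᵉ Q.tabooGreen :=
  inv_one_sub_nonneg Q.excursion_nonneg (Q.tendsto_excursion_pow h)

theorem tabooGreen_mul (h : Q.ReachesBelow) : Q.tabooGreen * (1 - Q.excursion) = 1 :=
  Matrix.nonsing_inv_mul _ ((Matrix.isUnit_iff_isUnit_det _).1 (isUnit_one_sub_excursion h))

theorem mul_tabooGreen (h : Q.ReachesBelow) : (1 - Q.excursion) * Q.tabooGreen = 1 :=
  Matrix.mul_nonsing_inv _ ((Matrix.isUnit_iff_isUnit_det _).1 (isUnit_one_sub_excursion h))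

theorem one_sub_excursion_mul_G (Q : QBD m) : (1 - Q.excursion) * Q.G = Q.Adown := by
  have h := Q.G_eq
  rw [sub_mul, one_mul, sub_eq_iff_eq_add]
  exact h

theorem tabooGreen_mul_Adown (h : Q.ReachesBelow) : Q.tabooGreen * Q.Adown = Q.G := by
  rw [← Q.one_sub_excursion_mul_G, ← Matrix.mul_assoc, tabooGreen_mul h, Matrix.one_mul]

/-- The map whose fixed points are the solutions of the equation for `R`. -/
def RMap (Q : QBD m) (X : Matrix (Fin m) (Fin m) ℝ) : Matrix (Fin m) (Fin m) ℝ :=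
  Q.Aup + X * Q.A0 + X * X * Q.Adown

theorem REquation_iff (X : Matrix (Fin m) (Fin m) ℝ) : Q.REquation X ↔ Q.RMap X = X := by
  rw [REquation, RMap, ← sub_eq_zero (b := X)]
  refine Eq.congr ?_ rfl
  noncomm_ring

theorem RMap_mono {X Y : Matrix (Fin m) (Fin m) ℝ} (hX : 0 ≤ᵉ X) (h : X ≤ᵉ Y) :
    Q.RMap X ≤ᵉ Q.RMap Y :=
  ((EntryLE.refl _).add (mul_right Q.A0_nonneg h)).add
    (mul_right Q.Adown_nonneg (mul hX (hX.trans h) h h))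

theorem continuous_RMap : Continuous Q.RMap :=
  (continuous_const.add (continuous_id.matrix_mul continuous_const)).add
    ((continuous_id.matrix_mul continuous_id).matrix_mul continuous_const)

theorem RMap_tabooGreen (h : Q.ReachesBelow) :
    Q.RMap (Q.Aup * Q.tabooGreen) = Q.Aup * Q.tabooGreen := by
  have h1 : Q.Aup * Q.tabooGreen * (Q.Aup * Q.tabooGreen) * Q.Adown =
      Q.Aup * Q.tabooGreen * Q.Aup * Q.G := by
    rw [← tabooGreen_mul_Adown h]; noncomm_ring
  have h2 : Q.Aup * Q.tabooGreen * (1 - (Q.A0 + Q.Aup * Q.G)) = Q.Aup := by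
    rw [← excursion, Matrix.mul_assoc, tabooGreen_mul h, Matrix.mul_one]
  rw [RMap, h1]
  nth_rewrite 1 [← h2]
  noncomm_ring

theorem exists_R (h : Q.ReachesBelow) : ∃ X, 0 ≤ᵉ X ∧ Q.RMap X = X ∧
    (∀ Z, 0 ≤ᵉ Z → Q.RMap Z ≤ᵉ Z → X ≤ᵉ Z) ∧
    ∀ D : Set (Matrix (Fin m) (Fin m) ℝ), IsClosed D → 0 ∈ D →
      (∀ Z, 0 ≤ᵉ Z → Z ∈ D → Q.RMap Z ∈ D) → X ∈ D := by
  have h0 : 0 ≤ᵉ Q.Aup * Q.tabooGreen := mul_nonneg Q.Aup_nonneg (tabooGreen_nonneg h)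
  refine exists_minimal_fixedPoint Q.RMap continuous_RMap (fun X Y => RMap_mono)
    (by rw [RMap]; simpa using! Q.Aup_nonneg) {X | X ≤ᵉ Q.Aup * Q.tabooGreen} h0
    (fun X hX0 hX => ?_) _ fun X hX => hX
  have h1 : Q.RMap X ≤ᵉ Q.RMap (Q.Aup * Q.tabooGreen) := RMap_mono hX0 hX
  rwa [RMap_tabooGreen h] at h1

theorem isMinimal_R_and_induction (h : Q.ReachesBelow) : IsMinimalNonneg Q.REquation Q.R ∧
    ∀ D : Set (Matrix (Fin m) (Fin m) ℝ), IsClosed D → 0 ∈ D →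
      (∀ Z, 0 ≤ᵉ Z → Z ∈ D → Q.RMap Z ∈ D) → Q.R ∈ D := by
  obtain ⟨X, h0, hX, hmin, hind⟩ := exists_R h
  have h : IsMinimalNonneg Q.REquation X :=
    ⟨h0, (REquation_iff X).2 hX, fun Y hY hYe =>
      hmin Y hY (((REquation_iff Y).1 hYe).symm ▸ EntryLE.refl _)⟩
  rw [R, minimalNonneg_eq h]
  exact ⟨h, hind⟩

theorem isMinimal_R (h : Q.ReachesBelow) : IsMinimalNonneg Q.REquation Q.R :=
  (isMinimal_R_and_induction h).1

theorem R_nonneg (h : Q.ReachesBelow) : 0 ≤ᵉ Q.R := (isMinimal_R h).1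

theorem RMap_R (h : Q.ReachesBelow) : Q.RMap Q.R = Q.R := (REquation_iff _).1 (isMinimal_R h).2.1

/-- Two minimality arguments squeeze `U`. Minimality of `R` gives `R ≤ A₁T`, hence `U ≤ A₀ + A₁G`
and `(I - U)⁻¹` exists and is nonnegative. Then `R = A₁(I - U)⁻¹`, and `(I - U)⁻¹A₋₁` solves the
equation for `G`, so minimality of `G` gives the reverse inequality. -/
theorem R_eq_and_U_eq (h : Q.ReachesBelow) :
    Q.R = Q.Aup * Q.tabooGreen ∧ Q.U = Q.excursion := by
  have hle : Q.R ≤ᵉ Q.Aup * Q.tabooGreen :=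
    (isMinimal_R h).2.2 _ (mul_nonneg Q.Aup_nonneg (tabooGreen_nonneg h))
      ((REquation_iff _).2 (RMap_tabooGreen h))
  have hUle : Q.U ≤ᵉ Q.excursion := by
    rw [U, excursion, ← tabooGreen_mul_Adown h, ← Matrix.mul_assoc]
    exact (EntryLE.refl _).add (mul_right Q.Adown_nonneg hle)
  have hU0 : 0 ≤ᵉ Q.U := add_nonneg Q.A0_nonneg (mul_nonneg (R_nonneg h) Q.Adown_nonneg)
  have hUt := tendsto_pow_of_le hU0 hUle (Q.tendsto_excursion_pow h)
  have hdet := (Matrix.isUnit_iff_isUnit_det _).1 (isUnit_one_sub_of_tendsto hUt)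
  set N := (1 - Q.U)⁻¹ with hN
  have hN0 : 0 ≤ᵉ N := inv_one_sub_nonneg hU0 hUt
  have hR : Q.R = Q.Aup * N := by
    have h1 : Q.R * (1 - Q.U) = Q.Aup := by
      have h2 := RMap_R h
      rw [RMap] at h2
      rw [U]
      linear_combination (norm := noncomm_ring) -h2
    rw [← h1, Matrix.mul_assoc, Matrix.mul_nonsing_inv _ hdet, Matrix.mul_one]
  have hG : Q.GEquation (N * Q.Adown) := by
    have h1 : (1 - (Q.A0 + Q.Aup * N * Q.Adown)) * N = 1 := by
      rw [← hR]; exact Matrix.mul_nonsing_inv _ hdet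
    rw [GEquation]
    linear_combination (norm := noncomm_ring) -(h1 * Q.Adown)
  have hGle : Q.G ≤ᵉ N * Q.Adown := Q.isMinimal_G.2.2 _ (mul_nonneg hN0 Q.Adown_nonneg) hG
  have hle' : Q.excursion ≤ᵉ Q.U := by
    rw [excursion, U, hR, Matrix.mul_assoc]
    exact (EntryLE.refl _).add (mul_left Q.Aup_nonneg hGle)
  have hUeq : Q.U = Q.excursion := hUle.antisymm hle'
  exact ⟨by rw [hR, hN, hUeq, tabooGreen], hUeq⟩

theorem R_eq (h : Q.ReachesBelow) : Q.R = Q.Aup * Q.tabooGreen := (R_eq_and_U_eq h).1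

theorem U_eq (h : Q.ReachesBelow) : Q.U = Q.excursion := (R_eq_and_U_eq h).2

theorem R_mul_one_sub_excursion (h : Q.ReachesBelow) : Q.R * (1 - Q.excursion) = Q.Aup := by
  rw [R_eq h, Matrix.mul_assoc, tabooGreen_mul h, Matrix.mul_one]

/-- With `π` stationary for `A₋₁ + A₀ + A₁`, the property `π X ≤ π` survives the iteration for `R`:
replacing every `π X` by `π` in `π (A₁ + X A₀ + X² A₋₁)` leaves `π`. -/
theorem exists_bound_R_pow [Nonempty (Fin m)] (h : Q.ReachesBelow)
    (hA : (Q.Adown + Q.A0 + Q.Aup).IsIrreducible) : ∃ C, ∀ k i j, (Q.R ^ k) i j ≤ C := by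
  obtain ⟨π, hpos, hπ⟩ := hA.exists_stationary (by simpa [Matrix.add_mulVec] using Q.row_sum)
  refine exists_bound_of_vecMul_le (R_nonneg h) hpos ?_
  refine (isMinimal_R_and_induction h).2 {X | π ᵥ* X ≤ π}
    (isClosed_le (continuous_const.matrix_vecMul continuous_id) continuous_const) ?_ ?_
  · change π ᵥ* (0 : Matrix (Fin m) (Fin m) ℝ) ≤ π
    rw [Matrix.vecMul_zero]
    exact fun i => (hpos i).le
  · intro Z hZ hZπ
    have h1 : (π ᵥ* Z) ᵥ* Z ≤ π := (EntryLE.vecMul_mono hZ hZπ).trans hZπ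
    have e : π ᵥ* Q.RMap Z =
        π ᵥ* Q.Aup + (π ᵥ* Z) ᵥ* Q.A0 + ((π ᵥ* Z) ᵥ* Z) ᵥ* Q.Adown := by
      simp only [RMap, Matrix.vecMul_add, Matrix.vecMul_vecMul]
    refine le_of_eq_of_le e (((add_le_add (add_le_add le_rfl (EntryLE.vecMul_mono Q.A0_nonneg hZπ))
      (EntryLE.vecMul_mono Q.Adown_nonneg h1))).trans_eq ?_)
    conv_rhs => rw [← hπ]
    simp only [Matrix.vecMul_add]
    abel

end QBD
open EntryLE

/-! ### Hitting probabilities and mean hitting times -/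

section Hitting

variable {S : Type*} {P : Matrix S S ℝ}

/-- The probability that the chain started in `s` is in `t` at some positive time. -/
noncomputable def hitProb (P : Matrix S S ℝ) (t s : S) : ℝ≥0∞ := ∑' n : ℕ, firstPassage P t n s

/-- The mean first passage time from `s` to `t`, on the event that the passage takes place. -/
noncomputable def meanHit (P : Matrix S S ℝ) (t s : S) : ℝ≥0∞ :=
  ∑' n : ℕ, ((n : ℝ≥0∞) + 1) * firstPassage P t n s

theorem tsum_mul_ite [DecidableEq S] (f g : S → ℝ≥0∞) (c : ℝ≥0∞) (t : S) :
    ∑' r, g r * (if r = t then c else f r) = g t * c + ∑' r : {r : S // r ≠ t}, g r * f r := by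
  rw [ENNReal.tsum_eq_add_tsum_ite t, if_pos rfl]
  congr 1
  rw [show (∑' r : {r : S // r ≠ t}, g r * f r) = ∑' r : ({r | r ≠ t} : Set S), g r * f r from rfl,
    tsum_subtype {r | r ≠ t} fun r => g r * f r]
  refine tsum_congr fun r => ?_
  by_cases h : r = t <;> simp [h]

/-- First-step analysis. The value at `t` must be replaced by `1`, because `hitProb P t t` counts
only positive times and is the return probability. -/
theorem hitProb_eq [DecidableEq S] (t s : S) :
    hitProb P t s = ∑' r, ENNReal.ofReal (P s r) * (if r = t then 1 else hitProb P t r) := by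
  rw [tsum_mul_ite, hitProb, tsum_eq_zero_add' ENNReal.summable, mul_one]
  congr 1
  simp only [firstPassage]
  rw [ENNReal.tsum_comm]
  simp only [ENNReal.tsum_mul_left, hitProb]

theorem meanHit_eq [DecidableEq S] (t s : S) : meanHit P t s =
    hitProb P t s + ∑' r, ENNReal.ofReal (P s r) * (if r = t then 0 else meanHit P t r) := by
  have h1 : meanHit P t s = hitProb P t s + ∑' n : ℕ, (n : ℝ≥0∞) * firstPassage P t n s := by
    rw [meanHit, hitProb, ← ENNReal.tsum_add]
    exact tsum_congr fun n => by ring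
  rw [h1, tsum_mul_ite, mul_zero, zero_add, tsum_eq_zero_add' ENNReal.summable]
  congr 1
  simp only [firstPassage, Nat.cast_zero, zero_mul, zero_add, ← ENNReal.tsum_mul_left]
  rw [ENNReal.tsum_comm]
  refine tsum_congr fun r => ?_
  rw [meanHit, ← ENNReal.tsum_mul_left]
  exact tsum_congr fun n => by push_cast; ring

/-- The first `N` terms give the probability of a passage within `N` steps, and first-step analysis
of these truncated sums carries the bound from `N` to `N + 1`. -/
theorem hitProb_le_one (hP : ∀ s, ∑' r, ENNReal.ofReal (P s r) = 1) (t s : S) :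
    hitProb P t s ≤ 1 := by
  classical
  have h : ∀ N s, ∑ n ∈ Finset.range N, firstPassage P t n s ≤ 1 := by
    intro N
    induction N with
    | zero => simp
    | succ N ih =>
      intro s
      rw [Finset.sum_range_succ']
      simp only [firstPassage]
      rw [← Summable.tsum_finsetSum fun _ _ => ENNReal.summable]
      simp only [← Finset.mul_sum]
      rw [add_comm, ← mul_one (ENNReal.ofReal (P s t)),
        ← tsum_mul_ite (fun r => ∑ n ∈ Finset.range N, firstPassage P t n r)
          (fun r => ENNReal.ofReal (P s r))]
      refine le_trans (ENNReal.tsum_le_tsum fun r => ?_) (hP s).le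
      refine mul_le_of_le_one_right' ?_
      split_ifs
      · exact le_rfl
      · exact ih r
  rw [hitProb, ENNReal.tsum_eq_iSup_nat]
  exact iSup_le fun N => h N s

theorem eq_one_of_tsum_mul_eq_one {p x : S → ℝ≥0∞} (hp : ∑' r, p r = 1) (hx : ∀ r, x r ≤ 1)
    (h : ∑' r, p r * x r = 1) {r : S} (hr : p r ≠ 0) : x r = 1 := by
  by_contra hne
  have hlt : x r < 1 := lt_of_le_of_ne (hx r) hne
  have hpr : p r ≠ ⊤ := ne_top_of_le_ne_top ENNReal.one_ne_top (hp ▸ ENNReal.le_tsum r)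
  have := ENNReal.tsum_lt_tsum (f := fun r => p r * x r) (g := p) (i := r)
    (by rw [h]; exact ENNReal.one_ne_top)
    (fun a => (mul_le_mul_right (hx a) _).trans_eq (mul_one _))
    (by simpa using (ENNReal.mul_lt_mul_iff_right hr hpr).2 hlt)
  rw [h, hp] at this
  exact lt_irrefl _ this

theorem eq_of_tsum_mul_le {p x : S → ℝ≥0∞} {c : ℝ≥0∞} (hp : ∑' r, p r = 1) (hc : c ≠ ⊤)
    (hx : ∀ r, c ≤ x r) (h : ∑' r, p r * x r ≤ c) {r : S} (hr : p r ≠ 0) : x r = c := by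
  by_contra hne
  have hlt : c < x r := lt_of_le_of_ne (hx r) (Ne.symm hne)
  have hpr : p r ≠ ⊤ := ne_top_of_le_ne_top ENNReal.one_ne_top (hp ▸ ENNReal.le_tsum r)
  have hsum : ∑' r, p r * c = c := by rw [ENNReal.tsum_mul_right, hp, one_mul]
  have := ENNReal.tsum_lt_tsum (f := fun r => p r * c) (g := fun r => p r * x r) (i := r)
    (by rw [hsum]; exact hc) (fun a => mul_le_mul_right (hx a) _)
    ((ENNReal.mul_lt_mul_iff_right hr hpr).2 hlt)
  rw [hsum] at this
  exact absurd h (not_le.2 this)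

theorem Matrix.IsIrreducible.reaches (hP : P.IsIrreducible) (s t : S) : Reaches P s t := by
  let : Quiver S := Matrix.toQuiver P
  obtain ⟨p, -⟩ := hP.connected s t
  clear * - p
  induction p with
  | nil => exact Relation.ReflTransGen.refl
  | cons _ e ih => exact ih.tail e.down

end Hitting

namespace QBD

variable {m : ℕ} {Q : QBD m}

/-! ### Level-wise form of the transition matrix -/

theorem tsum_P_succ (f : ℕ × Fin m → ℝ≥0∞) (n : ℕ) (i : Fin m) :
    ∑' r, ENNReal.ofReal (Q.P (n + 1, i) r) * f r =
      ∑ j, (ENNReal.ofReal (Q.Adown i j) * f (n, j) + ENNReal.ofReal (Q.A0 i j) * f (n + 1, j) +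
        ENNReal.ofReal (Q.Aup i j) * f (n + 2, j)) := by
  rw [ENNReal.tsum_prod (f := fun k j => ENNReal.ofReal (Q.P (n + 1, i) (k, j)) * f (k, j)),
    ENNReal.tsum_comm, tsum_fintype]
  refine Finset.sum_congr rfl fun j _ => ?_
  rw [tsum_eq_sum (s := {n, n + 1, n + 2})]
  · rw [Finset.sum_insert (by simp), Finset.sum_insert (by simp), Finset.sum_singleton, ← add_assoc]
    have hn : n ≠ n + 1 + 1 := by omega
    simp [P, hn]
  · intro k hk
    simp only [Finset.mem_insert, Finset.mem_singleton, not_or] at hk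
    rw [P, if_neg (by simp only; omega), if_neg (by simp only; omega), if_neg (by simp only; omega)]
    simp

theorem tsum_P_zero (f : ℕ × Fin m → ℝ≥0∞) (i : Fin m) :
    ∑' r, ENNReal.ofReal (Q.P (0, i) r) * f r =
      ∑ j, (ENNReal.ofReal (Q.B i j) * f (0, j) + ENNReal.ofReal (Q.Aup i j) * f (1, j)) := by
  rw [ENNReal.tsum_prod (f := fun k j => ENNReal.ofReal (Q.P (0, i) (k, j)) * f (k, j)),
    ENNReal.tsum_comm, tsum_fintype]
  refine Finset.sum_congr rfl fun j _ => ?_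
  rw [tsum_eq_sum (s := {0, 1})]
  · rw [Finset.sum_insert (by simp), Finset.sum_singleton]
    simp [P]
  · intro k hk
    simp only [Finset.mem_insert, Finset.mem_singleton, not_or] at hk
    rw [P, if_neg (by simp only; omega), if_neg (by simp only; omega), if_neg (by simp only; omega)]
    simp

theorem tsum_P (s : ℕ × Fin m) : ∑' r, ENNReal.ofReal (Q.P s r) = 1 := by
  obtain ⟨n, i⟩ := s
  cases n with
  | zero =>
    have h := Q.tsum_P_zero (fun _ => 1) i
    simp only [mul_one] at h
    rw [h, ← ENNReal.ofReal_one, ← Q.boundary_row_sum i,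
      ENNReal.ofReal_sum_of_nonneg fun j _ =>
        _root_.add_nonneg (Q.B_nonneg i j) (Q.Aup_nonneg i j)]
    exact Finset.sum_congr rfl fun j _ =>
      (ENNReal.ofReal_add (Q.B_nonneg i j) (Q.Aup_nonneg i j)).symm
  | succ n =>
    have h := Q.tsum_P_succ (fun _ => 1) n i
    simp only [mul_one] at h
    rw [h, ← ENNReal.ofReal_one, ← Q.interior_row_sum i,
      ENNReal.ofReal_sum_of_nonneg fun j _ => _root_.add_nonneg
        (_root_.add_nonneg (Q.Adown_nonneg i j) (Q.A0_nonneg i j)) (Q.Aup_nonneg i j)]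
    refine Finset.sum_congr rfl fun j _ => ?_
    rw [ENNReal.ofReal_add (_root_.add_nonneg (Q.Adown_nonneg i j) (Q.A0_nonneg i j))
      (Q.Aup_nonneg i j), ENNReal.ofReal_add (Q.Adown_nonneg i j) (Q.A0_nonneg i j)]

theorem tsum_P_succ_ofReal {v : ℕ → Fin m → ℝ} (hv : ∀ n, 0 ≤ v n) (n : ℕ) (i : Fin m) :
    ∑' r, ENNReal.ofReal (Q.P (n + 1, i) r) * ENNReal.ofReal (v r.1 r.2) =
      ENNReal.ofReal ((Q.Adown *ᵥ v n + Q.A0 *ᵥ v (n + 1) + Q.Aup *ᵥ v (n + 2)) i) := by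
  rw [tsum_P_succ]
  have h1 := fun j => _root_.mul_nonneg (Q.Adown_nonneg i j) (hv n j)
  have h2 := fun j => _root_.mul_nonneg (Q.A0_nonneg i j) (hv (n + 1) j)
  have h3 := fun j => _root_.mul_nonneg (Q.Aup_nonneg i j) (hv (n + 2) j)
  simp only [Pi.add_apply, Matrix.mulVec, dotProduct, ← Finset.sum_add_distrib]
  rw [ENNReal.ofReal_sum_of_nonneg fun j _ =>
    _root_.add_nonneg (_root_.add_nonneg (h1 j) (h2 j)) (h3 j)]
  refine Finset.sum_congr rfl fun j _ => ?_
  rw [ENNReal.ofReal_add (_root_.add_nonneg (h1 j) (h2 j)) (h3 j),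
    ENNReal.ofReal_add (h1 j) (h2 j), ENNReal.ofReal_mul (Q.Adown_nonneg i j),
    ENNReal.ofReal_mul (Q.A0_nonneg i j), ENNReal.ofReal_mul (Q.Aup_nonneg i j)]

/-- Optional stopping at the first passage one level down. The inequality is carried through the
iterates that define `G`, where `Z²` passes two levels and so needs it at two consecutive levels. -/
theorem G_mulVec_le_of_superharmonic {v : ℕ → Fin m → ℝ} (hv : ∀ n, 0 ≤ v n)
    (h : ∀ n, Q.Adown *ᵥ v n + Q.A0 *ᵥ v (n + 1) + Q.Aup *ᵥ v (n + 2) ≤ v (n + 1)) (n : ℕ) :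
    Q.G *ᵥ v n ≤ v (n + 1) := by
  refine Q.G_induction {X | ∀ n, X *ᵥ v n ≤ v (n + 1)} ?_ ?_ ?_ n
  · rw [Set.ofPred_forall]
    exact isClosed_iInter fun n =>
      isClosed_le (continuous_id.matrix_mulVec continuous_const) continuous_const
  · intro n
    rw [Matrix.zero_mulVec]
    exact hv _
  · intro Z hZ hZv n
    have h1 : Z *ᵥ Z *ᵥ v n ≤ v (n + 2) := (mulVec_left hZ (hZv n)).trans (hZv (n + 1))
    have e : Q.GMap Z *ᵥ v n = Q.Adown *ᵥ v n + Q.A0 *ᵥ Z *ᵥ v n + Q.Aup *ᵥ Z *ᵥ Z *ᵥ v n := by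
      simp only [GMap, Matrix.add_mulVec, Matrix.mulVec_mulVec, Matrix.mul_assoc]
    rw [e]
    exact (add_le_add (add_le_add le_rfl (mulVec_left Q.A0_nonneg (hZv n)))
      (mulVec_left Q.Aup_nonneg h1)).trans (h n)

/-! ### Positive recurrence -/

/-- The mean hitting time of a state `t` of level `0` drops by one on average at each step.
Certainty and finite mean of the passage hold at `t` and spread along the paths from `t`: a
successor `r' ≠ t` violating either would violate it for its predecessor too. -/
theorem exists_lyapunov [Nonempty (Fin m)] (hP : Q.P.IsIrreducible)
    (hpos : IsPositiveRecurrentChain Q.P) : ∃ v : ℕ → Fin m → ℝ, (∀ n, 0 ≤ v n) ∧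
      ∀ n, 1 + (Q.Adown *ᵥ v n + Q.A0 *ᵥ v (n + 1) + Q.Aup *ᵥ v (n + 2)) ≤ v (n + 1) := by
  classical
  obtain ⟨i₀⟩ := ‹Nonempty (Fin m)›
  set t : ℕ × Fin m := (0, i₀) with ht
  have hret : hitProb Q.P t t = 1 := (hpos t).1
  have hgood : ∀ r, hitProb Q.P t r = 1 ∧ meanHit Q.P t r ≠ ⊤ := by
    intro r
    induction hP.reaches t r with
    | refl => exact ⟨hret, (hpos t).2.ne⟩
    | @tail r r' _ hrr ih =>
      by_cases hr' : r' = t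
      · rw [hr']
        exact ⟨hret, (hpos t).2.ne⟩
      have hne : ENNReal.ofReal (Q.P r r') ≠ 0 := by simpa using hrr
      constructor
      · have h1 := ih.1
        rw [hitProb_eq] at h1
        have h2 := eq_one_of_tsum_mul_eq_one (tsum_P r) (fun r' => ?_) h1 hne
        · simpa [hr'] using h2
        · split_ifs
          · exact le_rfl
          · exact hitProb_le_one tsum_P t r'
      · intro htop
        apply ih.2
        rw [meanHit_eq, ENNReal.add_eq_top]
        right
        refine top_le_iff.1 (le_trans ?_ (ENNReal.le_tsum r'))
        rw [if_neg hr', htop, ENNReal.mul_top hne]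
  -- The time to hit `t` is zero at `t` itself, unlike the return time `meanHit`. The drift equation
  -- fails only at `t`, which has level `0`, so it holds at all levels `n + 1`.
  set e : ℕ × Fin m → ℝ≥0∞ := fun r => if r = t then 0 else meanHit Q.P t r with he
  have hetop : ∀ r, e r ≠ ⊤ := by
    intro r
    simp only [he]
    split_ifs
    · exact ENNReal.zero_ne_top
    · exact (hgood r).2
  refine ⟨fun n i => (e (n, i)).toReal, fun n i => ENNReal.toReal_nonneg, fun n i => ?_⟩
  have h1 := tsum_P_succ_ofReal (Q := Q) (v := fun n i => (e (n, i)).toReal)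
    (fun n i => ENNReal.toReal_nonneg) n i
  simp only [ENNReal.ofReal_toReal (hetop _), Prod.mk.eta] at h1
  have h2 : e (n + 1, i) = 1 + ∑' r, ENNReal.ofReal (Q.P (n + 1, i) r) * e r := by
    have hne : ((n + 1, i) : ℕ × Fin m) ≠ t := by simp [ht]
    simp only [he]
    rw [if_neg hne, meanHit_eq, (hgood _).1]
  rw [h1] at h2
  rw [Pi.add_apply, Pi.one_apply, ← ENNReal.ofReal_le_iff_le_toReal (hetop _), h2]
  exact ENNReal.ofReal_add_le.trans_eq (by rw [ENNReal.ofReal_one])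

/-- The factorization of the drift operator through `G`, `I - A₀ - A₁G` and `R` transforms the
Lyapunov inequality into `1 + R y (n + 1) ≤ y n` with `y ≥ 0`. Iterating it bounds every partial sum
of `∑ Rᵏ 1` by `y 0`. -/
theorem summable_R_pow_of_lyapunov (h : Q.ReachesBelow) {v : ℕ → Fin m → ℝ} (hv : ∀ n, 0 ≤ v n)
    (hlyap : ∀ n, 1 + (Q.Adown *ᵥ v n + Q.A0 *ᵥ v (n + 1) + Q.Aup *ᵥ v (n + 2)) ≤ v (n + 1))
    (i j : Fin m) : Summable fun k => (Q.R ^ k) i j := by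
  have hG := G_mulVec_le_of_superharmonic (Q := Q) hv fun n =>
    (le_add_of_nonneg_left zero_le_one).trans (hlyap n)
  set d : ℕ → Fin m → ℝ := fun n => v (n + 1) - Q.G *ᵥ v n with hd
  have hd0 : ∀ n, 0 ≤ d n := fun n => sub_nonneg.2 (hG n)
  set y : ℕ → Fin m → ℝ := fun n => (1 - Q.excursion) *ᵥ d n with hy
  have hstep : ∀ n, 1 + Q.R *ᵥ y (n + 1) ≤ y n := by
    intro n
    have e1 : Q.R *ᵥ y (n + 1) = Q.Aup *ᵥ v (n + 2) - Q.Aup *ᵥ Q.G *ᵥ v (n + 1) := by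
      simp only [hy, hd]
      rw [Matrix.mulVec_mulVec, R_mul_one_sub_excursion h, Matrix.mulVec_sub]
    have e2 : y n = v (n + 1) - Q.A0 *ᵥ v (n + 1) - Q.Aup *ᵥ Q.G *ᵥ v (n + 1) - Q.Adown *ᵥ v n := by
      simp only [hy, hd]
      rw [Matrix.mulVec_sub, Matrix.mulVec_mulVec, one_sub_excursion_mul_G, excursion,
        Matrix.sub_mulVec, Matrix.add_mulVec, Matrix.one_mulVec, Matrix.mulVec_mulVec]
      abel
    intro i
    have h3 := hlyap n i
    rw [e1, e2]
    simp only [Pi.add_apply, Pi.sub_apply] at h3 ⊢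
    linarith
  have hR := R_nonneg h
  have hy0 : ∀ n, 0 ≤ y n := by
    intro n
    have e1 : Q.R *ᵥ y (n + 1) = Q.Aup *ᵥ d (n + 1) := by
      simp only [hy]
      rw [Matrix.mulVec_mulVec, R_mul_one_sub_excursion h]
    refine le_trans ?_ (hstep n)
    rw [e1]
    exact _root_.add_nonneg zero_le_one (mulVec_nonneg Q.Aup_nonneg (hd0 _))
  have hsum : ∀ K n, ∑ k ∈ Finset.range K, Q.R ^ k *ᵥ (1 : Fin m → ℝ) ≤ y n := by
    intro K
    induction K with
    | zero => simpa using hy0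
    | succ K ih =>
      intro n
      refine le_trans ?_ (hstep n)
      rw [Finset.sum_range_succ', add_comm]
      simp only [pow_succ', pow_zero, Matrix.one_mulVec, ← Matrix.mulVec_mulVec]
      rw [← Matrix.mulVec_sum]
      exact add_le_add le_rfl (mulVec_left hR (ih (n + 1)))
  refine summable_of_sum_range_le (c := y 0 i) (fun k => pow_nonneg hR k i j) fun K => ?_
  refine le_trans ?_ (hsum K 0 i)
  rw [Finset.sum_apply]
  refine Finset.sum_le_sum fun k _ => ?_
  have : (Q.R ^ k *ᵥ (1 : Fin m → ℝ)) i = ∑ l, (Q.R ^ k) i l := by simp [Matrix.mulVec, dotProduct]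
  rw [this]
  exact Finset.single_le_sum (f := fun l => (Q.R ^ k) i l) (fun l _ => pow_nonneg hR k i l)
    (Finset.mem_univ j)

/-! ### Transience -/

/-- Suppose `G` is stochastic. Then the hitting probability of a state `t` of level `0` is minimized
on level `0`, since each level dominates `G` applied to the one below. The minimum principle along a
path to `t` shows that the minimum is `1`, so the return to `t` is certain. -/
theorem G_mulVec_one_ne [Nonempty (Fin m)] (hP : Q.P.IsIrreducible)
    (htrans : IsTransientChain Q.P) : Q.G *ᵥ 1 ≠ 1 := by
  classical
  intro hG1
  obtain ⟨i₀⟩ := ‹Nonempty (Fin m)›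
  set t : ℕ × Fin m := (0, i₀) with ht
  set e : ℕ × Fin m → ℝ≥0∞ := fun r => if r = t then 1 else hitProb Q.P t r with he
  have hP1 := tsum_P (Q := Q)
  have hetop : ∀ r, e r ≠ ⊤ := by
    intro r
    simp only [he]
    split_ifs
    · exact ENNReal.one_ne_top
    · exact ne_top_of_le_ne_top ENNReal.one_ne_top (hitProb_le_one hP1 t r)
  have het : e t = 1 := by simp [he]
  have hharm : ∀ r, r ≠ t → ∑' r', ENNReal.ofReal (Q.P r r') * e r' = e r := by
    intro r hr
    simp only [he]
    rw [if_neg hr, hitProb_eq]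
  set v : ℕ → Fin m → ℝ := fun n i => (e (n, i)).toReal with hvdef
  have hv : ∀ n, 0 ≤ v n := fun n i => ENNReal.toReal_nonneg
  have hG := G_mulVec_le_of_superharmonic (Q := Q) hv fun n i => by
    have h1 := tsum_P_succ_ofReal (Q := Q) hv n i
    simp only [hvdef, ENNReal.ofReal_toReal (hetop _), Prod.mk.eta] at h1
    rw [hharm _ (by simp [ht])] at h1
    exact (ENNReal.ofReal_le_iff_le_toReal (hetop _)).1 h1.ge
  obtain ⟨i₁, -, hmin⟩ := Finset.exists_min_image Finset.univ (v 0) ⟨i₀, Finset.mem_univ _⟩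
  set c := v 0 i₁ with hc
  have hvc : ∀ n, (fun _ => c) ≤ v n := by
    intro n
    induction n with
    | zero => exact fun i => hmin i (Finset.mem_univ i)
    | succ n ih =>
      refine le_trans ?_ (hG n)
      refine le_trans (le_of_eq ?_) (mulVec_left Q.G_nonneg ih)
      have e2 : (fun _ => c : Fin m → ℝ) = c • 1 := by ext; simp
      rw [e2, Matrix.mulVec_smul, hG1]
  have hec : ∀ r, ENNReal.ofReal c ≤ e r := fun r =>
    (ENNReal.ofReal_le_iff_le_toReal (hetop r)).2 (hvc r.1 r.2)
  -- The second alternative covers paths through `t`, where `e` need not be harmonic but its value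
  -- `1` is then the minimum.
  have hpath : ∀ r, Reaches Q.P (0, i₁) r → e r = ENNReal.ofReal c ∨ ENNReal.ofReal c = 1 := by
    intro r hr
    induction hr with
    | refl => left; rw [hc]; exact (ENNReal.ofReal_toReal (hetop _)).symm
    | @tail r r' _ hrr ih =>
      rcases ih with ih | ih
      · by_cases hrt : r = t
        · right; rw [← ih, hrt, het]
        · left
          exact eq_of_tsum_mul_le (hP1 r) ENNReal.ofReal_ne_top hec
            ((hharm r hrt).trans ih).le (by simpa using hrr)
      · exact Or.inr ih
  have hc1 : ENNReal.ofReal c = 1 := by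
    rcases hpath t (hP.reaches _ _) with h | h
    · rw [← h, het]
    · exact h
  refine absurd (htrans t) (not_lt.2 ?_)
  change 1 ≤ hitProb Q.P t t
  rw [hitProb_eq]
  refine (hP1 t).symm.trans_le ?_
  refine ENNReal.tsum_le_tsum fun r => ?_
  refine (mul_one _).symm.trans_le (mul_le_mul_right ?_ _)
  have h1 := hec r
  rwa [hc1] at h1

/-- Applying the equation for `G` to a fixed vector of `G` shows that `A₋₁ + A₀ + A₁` fixes it too.
By irreducibility and the maximum principle it is constant, and a nonzero constant would make `G`
stochastic. -/
theorem tendsto_G_pow (hA : (Q.Adown + Q.A0 + Q.Aup).IsIrreducible) (hG1 : Q.G *ᵥ 1 ≠ 1) :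
    Tendsto (fun s => Q.G ^ s) atTop (𝓝 0) := by
  refine tendsto_pow_of_substochastic Q.G_nonneg Q.G_mulVec_one fun u hu0 hu1 hfix => ?_
  by_contra hne
  obtain ⟨i₁, hi₁⟩ := Function.ne_iff.1 hne
  obtain ⟨i₀, -, hmax⟩ := Finset.exists_max_image Finset.univ u ⟨i₁, Finset.mem_univ _⟩
  have hcpos : 0 < u i₀ :=
    lt_of_lt_of_le (lt_of_le_of_ne (hu0 i₁) (Ne.symm hi₁)) (hmax i₁ (Finset.mem_univ _))
  have hAu : (Q.Adown + Q.A0 + Q.Aup) *ᵥ u = u := by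
    have h1 : Q.GMap Q.G *ᵥ u = u := by rw [Q.GMap_G, hfix]
    rwa [GMap, Matrix.add_mulVec, Matrix.add_mulVec, ← Matrix.mulVec_mulVec,
      ← Matrix.mulVec_mulVec, ← Matrix.mulVec_mulVec, hfix, hfix, ← Matrix.add_mulVec,
      ← Matrix.add_mulVec] at h1
  have hconst : ∀ j, u j = u i₀ := by
    intro j
    induction hA.reaches i₀ j with
    | refl => rfl
    | @tail k l _ hkl ih =>
      refine mulVec_apply_eq_of_le (i := k) hA.nonneg (fun j => hmax j (Finset.mem_univ j)) ?_ hkl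
      rw [hAu, ih]
      have := Q.interior_row_sum k
      simp only [Matrix.add_apply, this, mul_one]
  apply hG1
  have e : u = u i₀ • 1 := by ext j; simp [hconst j]
  rw [e, Matrix.mulVec_smul] at hfix
  exact smul_right_injective _ hcpos.ne' hfix

/-! ### Convergence of the series `W` -/

theorem U_sub_one_inv (h : Q.ReachesBelow) : (Q.U - 1)⁻¹ = -Q.tabooGreen := by
  refine Matrix.inv_eq_right_inv ?_
  rw [U_eq h]
  linear_combination (norm := noncomm_ring) mul_tabooGreen h

theorem isUnit_U_sub_one (h : Q.ReachesBelow) : IsUnit (Q.U - 1) := by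
  rw [U_eq h, ← neg_sub]
  exact (isUnit_one_sub_excursion h).neg

theorem WTerm_eq (h : Q.ReachesBelow) (j : ℕ) :
    Q.WTerm j = -(Q.G ^ j * Q.tabooGreen * Q.R ^ j) := by
  rw [WTerm, U_sub_one_inv h]
  noncomm_ring

theorem summable_green [Nonempty (Fin m)] (h : Q.ReachesBelow) (hP : Q.P.IsIrreducible)
    (hA : (Q.Adown + Q.A0 + Q.Aup).IsIrreducible) (hQ : Q.NotNullRecurrent) :
    Summable fun j => Q.G ^ j * Q.tabooGreen * Q.R ^ j := by
  have hG := Q.G_nonneg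
  have hR := R_nonneg h
  rcases hQ with hQ | hQ
  · obtain ⟨v, hv, hlyap⟩ := exists_lyapunov hP hQ
    refine summable_mul_mul_right (C := 1) (fun s => pow_nonneg hG s) (fun s i j => ?_)
      (tabooGreen_nonneg h) (fun s => pow_nonneg hR s) (summable_R_pow_of_lyapunov h hv hlyap)
    have h1 : ∀ s, Q.G ^ s *ᵥ 1 ≤ 1 := by
      intro s
      induction s with
      | zero => simp
      | succ s ih =>
        rw [pow_succ', ← Matrix.mulVec_mulVec]
        exact (mulVec_left hG ih).trans Q.G_mulVec_one
    refine le_trans ?_ (h1 s i)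
    have : (Q.G ^ s *ᵥ (1 : Fin m → ℝ)) i = ∑ l, (Q.G ^ s) i l := by
      simp [Matrix.mulVec, dotProduct]
    rw [this]
    exact Finset.single_le_sum (f := fun l => (Q.G ^ s) i l) (fun l _ => pow_nonneg hG s i l)
      (Finset.mem_univ j)
  · obtain ⟨C, hC⟩ := exists_bound_R_pow h hA
    exact summable_mul_mul_left (C := C)
      (fun i j => (hasSum_pow_of_tendsto hG
        (tendsto_G_pow hA (G_mulVec_one_ne hP hQ)) i j).summable)
      (fun s => pow_nonneg hG s) (tabooGreen_nonneg h) (fun s => pow_nonneg hR s) hC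

end QBD
open EntryLE

namespace QBD

variable {m : ℕ} {Q : QBD m}

/-! ### Consequences of the unique final class -/

theorem HasUniqueFinalClass.nonempty (h : Q.HasUniqueFinalClass) : Nonempty (Fin m) :=
  let ⟨_, ⟨i, _⟩, _⟩ := h
  ⟨i⟩

theorem HasUniqueFinalClass.exists_reaches (h : Q.HasUniqueFinalClass) (i : Fin m) (z : ℤ) :
    ∃ j, Reaches Q.doublyInfinite (0, i) (z, j) := by
  obtain ⟨Es, -, hconn, -, hall⟩ := h
  obtain ⟨t, ht, hreach⟩ := hall (0, i)
  exact ⟨t.2, hreach.trans (hconn t (z, t.2) ht ht)⟩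

theorem HasUniqueFinalClass.reachesBelow (h : Q.HasUniqueFinalClass) : Q.ReachesBelow := fun i =>
  let ⟨j, hj⟩ := h.exists_reaches i (-1)
  ⟨(-1, j), by simp, hj⟩

theorem rev_doublyInfinite (s t : ℤ × Fin m) :
    Q.rev.doublyInfinite (-s.1, s.2) (-t.1, t.2) = Q.doublyInfinite s t := by
  simp only [doublyInfinite, rev]
  split_ifs <;> first | rfl | (exfalso; omega)

theorem HasUniqueFinalClass.rev_reachesBelow (h : Q.HasUniqueFinalClass) : Q.rev.ReachesBelow := by
  intro i
  obtain ⟨j, hj⟩ := h.exists_reaches i 1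
  refine ⟨(-1, j), by simp, ?_⟩
  have key : ∀ t, Reaches Q.doublyInfinite (0, i) t →
      Reaches Q.rev.doublyInfinite (0, i) (-t.1, t.2) := by
    intro t ht
    induction ht with
    | refl => exact Relation.ReflTransGen.refl
    | tail _ hst ih => exact ih.tail (by rwa [rev_doublyInfinite])
  exact key _ hj

/-- Used for the reversed process, where it says that `A₁`, the leading coefficient of `η`, is
nonzero. -/
theorem ReachesBelow.Adown_ne_zero [Nonempty (Fin m)] (h : Q.ReachesBelow) : Q.Adown ≠ 0 := by
  intro h0
  obtain ⟨i⟩ := ‹Nonempty (Fin m)›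
  obtain ⟨t, ht, hreach⟩ := h i
  have key : ∀ t, Reaches Q.doublyInfinite (0, i) t → 0 ≤ t.1 := by
    intro t ht
    induction ht with
    | refl => exact le_rfl
    | tail _ hst ih =>
      simp only [doublyInfinite, h0, Matrix.zero_apply, ite_self] at hst
      split_ifs at hst with h1 h2
      · omega
      · omega
      · exact absurd hst (lt_irrefl 0)
  exact absurd (key t hreach) (not_le.2 ht)

/-! ### The Green matrix of the doubly infinite chain -/

/-- The expected numbers of visits of the doubly infinite chain to its initial level. -/
noncomputable def green (Q : QBD m) : Matrix (Fin m) (Fin m) ℝ :=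
  ∑' j, Q.G ^ j * Q.tabooGreen * Q.R ^ j

/-- The expected numbers of visits to the initial level before the passage `s` levels down. -/
noncomputable def partialGreen (Q : QBD m) (s : ℕ) : Matrix (Fin m) (Fin m) ℝ :=
  ∑ j ∈ Finset.range s, Q.G ^ j * Q.tabooGreen * Q.R ^ j

theorem W_eq_neg_green (h : Q.ReachesBelow) : Q.W = -Q.green := by
  rw [W, green, ← tsum_neg]
  exact tsum_congr fun j => WTerm_eq h j

theorem partialGreen_succ (s : ℕ) :
    Q.partialGreen (s + 1) = Q.tabooGreen + Q.G * Q.partialGreen s * Q.R := by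
  rw [partialGreen, Finset.sum_range_succ', partialGreen, Finset.mul_sum, Finset.sum_mul, add_comm]
  congr 1
  · simp
  · refine Finset.sum_congr rfl fun j _ => ?_
    rw [pow_succ', pow_succ]
    simp only [Matrix.mul_assoc]

/-- The three products count visits to one fixed level, from that level and from one and two levels
below it, all killed at the same lower level. The identity is harmonicity in the middle starting
level. -/
theorem partialGreen_harmonic (h : Q.ReachesBelow) (s : ℕ) :
    Q.Aup * Q.partialGreen (s + 2) + (Q.A0 - 1) * (Q.partialGreen (s + 1) * Q.R) +
      Q.Adown * (Q.partialGreen s * Q.R) * Q.R = 0 := by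
  have e2 := partialGreen_succ (Q := Q) (s + 1)
  have e1 := congrArg (fun X => (Q.excursion - 1) * X * Q.R) (partialGreen_succ (Q := Q) s)
  have e0 := one_sub_excursion_mul_G Q
  have eN := mul_tabooGreen h
  have eR := R_eq h
  rw [e2, Matrix.mul_add, ← eR]
  rw [← e0]
  rw [excursion] at *
  linear_combination (norm := noncomm_ring) e1 - eN * Q.R

theorem partialGreen_nonneg (h : Q.ReachesBelow) (s : ℕ) : 0 ≤ᵉ Q.partialGreen s := by
  induction s with
  | zero => simpa [partialGreen] using EntryLE.refl _
  | succ s ih =>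
    rw [partialGreen_succ]
    exact add_nonneg (tabooGreen_nonneg h) (mul_nonneg (mul_nonneg Q.G_nonneg ih) (R_nonneg h))

theorem Ghat_nonneg : 0 ≤ᵉ Q.Ghat := Q.rev.G_nonneg

/-- Both sides count visits to the level above the start, but the right side ignores killing before
the first entrance. Algebraically, after the nonnegative factor `Q.rev.tabooGreen` is taken out, the
difference at `s + 1` is the difference at `s` between `A₋₁` and `R`. -/
theorem partialGreen_mul_R_le (h : Q.ReachesBelow) (hr : Q.rev.ReachesBelow) (s : ℕ) :
    Q.partialGreen s * Q.R ≤ᵉ Q.Ghat * Q.partialGreen (s + 1) := by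
  induction s with
  | zero =>
    have e : Q.partialGreen 0 = 0 := by simp [partialGreen]
    rw [e, Matrix.zero_mul]
    exact mul_nonneg Ghat_nonneg (partialGreen_nonneg h 1)
  | succ s ih =>
    have e : Q.Ghat * Q.partialGreen (s + 2) =
        Q.rev.tabooGreen * (Q.Aup * Q.partialGreen (s + 2)) := by
      rw [← Matrix.mul_assoc]
      exact congrArg (· * Q.partialGreen (s + 2)) (tabooGreen_mul_Adown hr).symm
    have e' : Q.partialGreen (s + 1) * Q.R = Q.rev.tabooGreen *
        ((1 - (Q.A0 + Q.Adown * Q.Ghat)) * (Q.partialGreen (s + 1) * Q.R)) := by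
      rw [← Matrix.mul_assoc Q.rev.tabooGreen]
      exact (Matrix.one_mul _).symm.trans
        (congrArg (· * (Q.partialGreen (s + 1) * Q.R)) (tabooGreen_mul hr).symm)
    rw [e', e]
    refine mul_left (tabooGreen_nonneg hr) (EntryLE.sub_nonneg.1 ?_)
    have h1 := partialGreen_harmonic h s
    have e2 : Q.Aup * Q.partialGreen (s + 2) -
        (1 - (Q.A0 + Q.Adown * Q.Ghat)) * (Q.partialGreen (s + 1) * Q.R) =
        Q.Adown * (Q.Ghat * Q.partialGreen (s + 1) - Q.partialGreen s * Q.R) * Q.R := by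
      linear_combination (norm := noncomm_ring) h1
    rw [e2]
    exact mul_nonneg (mul_nonneg Q.Adown_nonneg (EntryLE.sub_nonneg.2 ih)) (R_nonneg h)

theorem tendsto_partialGreen (hsum : Summable fun j => Q.G ^ j * Q.tabooGreen * Q.R ^ j) :
    Tendsto Q.partialGreen atTop (𝓝 Q.green) :=
  hsum.hasSum.tendsto_sum_nat

theorem green_eq (hsum : Summable fun j => Q.G ^ j * Q.tabooGreen * Q.R ^ j) :
    Q.green = Q.tabooGreen + Q.G * Q.green * Q.R := by
  have h1 := tendsto_partialGreen hsum
  have hc : Continuous fun X : Matrix (Fin m) (Fin m) ℝ => Q.tabooGreen + Q.G * X * Q.R :=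
    continuous_const.add ((continuous_const.matrix_mul continuous_id).matrix_mul continuous_const)
  refine tendsto_nhds_unique ((tendsto_add_atTop_iff_nat 1).2 h1) ?_
  exact ((hc.tendsto _).comp h1).congr fun s => (partialGreen_succ s).symm

/-- One inequality is the limit of `partialGreen_mul_R_le`. For the other, harmonicity of the Green
matrix lets `Z N ≤ N R` pass through the iterates `Z` that converge to `Ĝ`. -/
theorem green_mul_R (h : Q.ReachesBelow) (hr : Q.rev.ReachesBelow)
    (hsum : Summable fun j => Q.G ^ j * Q.tabooGreen * Q.R ^ j) :
    Q.green * Q.R = Q.Ghat * Q.green := by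
  have ht := tendsto_partialGreen hsum
  have hR := R_nonneg h
  have hN : 0 ≤ᵉ Q.green := of_tendsto tendsto_const_nhds ht (partialGreen_nonneg h)
  have hcR : Continuous fun X : Matrix (Fin m) (Fin m) ℝ => X * Q.R :=
    continuous_id.matrix_mul continuous_const
  have hcG : Continuous fun X : Matrix (Fin m) (Fin m) ℝ => Q.Ghat * X :=
    continuous_const.matrix_mul continuous_id
  have hharm : Q.Aup * Q.green + (Q.A0 - 1) * (Q.green * Q.R) +
      Q.Adown * (Q.green * Q.R) * Q.R = 0 := by
    have e1 := congrArg (fun X => (Q.excursion - 1) * X * Q.R) (green_eq hsum)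
    have e2 := congrArg (Q.Aup * ·) (green_eq hsum)
    have e0 := one_sub_excursion_mul_G Q
    have eN := mul_tabooGreen h
    have eR := R_eq h
    simp only [Matrix.mul_add Q.Aup, ← eR] at e2
    rw [← e0]
    rw [excursion] at *
    linear_combination (norm := noncomm_ring) e2 + e1 - eN * Q.R
  refine EntryLE.antisymm ?_ ?_
  · exact of_tendsto ((hcR.tendsto _).comp ht)
      ((hcG.tendsto _).comp ((tendsto_add_atTop_iff_nat 1).2 ht)) (partialGreen_mul_R_le h hr)
  · refine Q.rev.G_induction {X | X * Q.green ≤ᵉ Q.green * Q.R}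
      (EntryLE.isClosed_setOf (continuous_id.matrix_mul continuous_const) continuous_const) ?_ ?_
    · change (0 : Matrix (Fin m) (Fin m) ℝ) * Q.green ≤ᵉ Q.green * Q.R
      rw [Matrix.zero_mul]
      exact mul_nonneg hN hR
    · intro Z hZ hZN
      change Z * Q.green ≤ᵉ Q.green * Q.R at hZN
      have h1 : Z * (Z * Q.green) ≤ᵉ Q.green * Q.R * Q.R := by
        refine (mul_left hZ hZN).trans ?_
        rw [← Matrix.mul_assoc]
        exact mul_right hR hZN
      have h2 := ((EntryLE.refl (Q.Aup * Q.green)).add (mul_left Q.A0_nonneg hZN)).add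
        (mul_left Q.Adown_nonneg h1)
      have e1 : Q.rev.GMap Z * Q.green =
          Q.Aup * Q.green + Q.A0 * (Z * Q.green) + Q.Adown * (Z * (Z * Q.green)) := by
        simp only [GMap, rev]
        noncomm_ring
      have e2 : Q.green * Q.R = Q.Aup * Q.green + Q.A0 * (Q.green * Q.R) +
          Q.Adown * (Q.green * Q.R * Q.R) := by
        linear_combination (norm := noncomm_ring) -hharm
      change Q.rev.GMap Z * Q.green ≤ᵉ Q.green * Q.R
      rw [e1, e2]
      exact h2

theorem one_sub_G_mul_Ghat_mul_green (h : Q.ReachesBelow) (hr : Q.rev.ReachesBelow)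
    (hsum : Summable fun j => Q.G ^ j * Q.tabooGreen * Q.R ^ j) :
    (1 - Q.G * Q.Ghat) * Q.green = Q.tabooGreen := by
  have e1 := green_eq hsum
  have e2 := green_mul_R h hr hsum
  linear_combination (norm := noncomm_ring) e1 + Q.G * e2

theorem one_sub_G_mul_Ghat_mul_eq_one (h : Q.ReachesBelow) (hr : Q.rev.ReachesBelow)
    (hsum : Summable fun j => Q.G ^ j * Q.tabooGreen * Q.R ^ j) :
    (1 - Q.G * Q.Ghat) * (Q.green * (1 - Q.excursion)) = 1 := by
  rw [← Matrix.mul_assoc, one_sub_G_mul_Ghat_mul_green h hr hsum, tabooGreen_mul h]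

/-- Since `A₋₁ = (I - A₀ - A₁G) G`, the left factor equals `-(I - A₀ - A₁G)(I - GĜ)`. -/
theorem mul_W_eq_one (h : Q.ReachesBelow) (hr : Q.rev.ReachesBelow)
    (hsum : Summable fun j => Q.G ^ j * Q.tabooGreen * Q.R ^ j) :
    (Q.Aup * Q.G + (Q.A0 - 1) + Q.Adown * Q.Ghat) * Q.W = 1 := by
  have e1 := congrArg ((1 - Q.excursion) * ·) (one_sub_G_mul_Ghat_mul_green h hr hsum)
  have e0 := one_sub_excursion_mul_G Q
  simp only [mul_tabooGreen h] at e1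
  rw [W_eq_neg_green h, ← e0]
  rw [excursion] at *
  linear_combination (norm := noncomm_ring) e1

end QBD

/-! ### Quadratic matrix polynomials with two solvents -/

theorem Matrix.fromCols_add_fromCols {n α β : Type*} (A C : Matrix n α ℂ) (B D : Matrix n β ℂ) :
    Matrix.fromCols A B + Matrix.fromCols C D = Matrix.fromCols (A + C) (B + D) := by
  ext i (j | j) <;> rfl

theorem matPolyEval_quadratic {n : Type*} {a b c : Matrix n n ℂ} (z : ℂ) :
    matPolyEval ![a, b, c] z = a + z • b + z ^ 2 • c := by
  simp [matPolyEval, Fin.sum_univ_three]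

section Solvents

variable {n α β : Type*} [Fintype n] [DecidableEq n] [Fintype α] [DecidableEq α]
  [Fintype β] [DecidableEq β]
  {a b c g h w : Matrix n n ℂ}

theorem quadratic_eq_mul_sub (hg : a + b * g + c * (g * g) = 0) (z : ℂ) :
    a + z • b + z ^ 2 • c = (z • c + b + c * g) * (z • 1 - g) := by
  have e : a = -(b * g + c * (g * g)) := by
    rw [eq_neg_iff_add_eq_zero, ← hg]; abel
  rw [e]
  simp only [add_mul, mul_sub, smul_mul_assoc, mul_smul_comm, mul_one, smul_smul, ← pow_two,
    Matrix.mul_assoc, smul_add]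
  abel

theorem quadratic_eq_mul_one_sub (hh : c + b * h + a * (h * h) = 0) (z : ℂ) :
    a + z • b + z ^ 2 • c = (a + z • (b + a * h)) * (1 - z • h) := by
  have e : c = -(b * h + a * (h * h)) := by
    rw [eq_neg_iff_add_eq_zero, ← hh]; abel
  rw [e]
  simp only [add_mul, mul_sub, smul_mul_assoc, mul_smul_comm, mul_one, smul_smul, ← pow_two,
    Matrix.mul_assoc, smul_add, smul_neg]
  abel

theorem Matrix.isUnit_of_isUnit_mul {A B : Matrix n n ℂ} (hAB : IsUnit (A * B)) : IsUnit B := by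
  rw [Matrix.isUnit_iff_isUnit_det] at *
  rw [Matrix.det_mul] at hAB
  exact isUnit_of_mul_isUnit_right hAB

/-- Multiplying the claimed inverse by the polynomial leaves the cofactors `zc + b + cg` and `(a +
z(b + ah))h`; as `c = -(b + ah)h`, the terms in `z` cancel and the sum is `cg + b + ah`, which `w`
inverts. -/
theorem quadratic_inv (hg : a + b * g + c * (g * g) = 0) (hh : c + b * h + a * (h * h) = 0)
    (hw : (c * g + b + a * h) * w = 1) {z : ℂ} (hz : IsUnit (a + z • b + z ^ 2 • c)) :
    IsUnit (z • 1 - g) ∧ IsUnit (1 - z • h) ∧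
      (a + z • b + z ^ 2 • c)⁻¹ = ((z • 1 - g)⁻¹ + (1 - z • h)⁻¹ * h) * w := by
  have h1 : IsUnit (z • 1 - g) := Matrix.isUnit_of_isUnit_mul (quadratic_eq_mul_sub hg z ▸ hz)
  have h2 : IsUnit (1 - z • h) := Matrix.isUnit_of_isUnit_mul (quadratic_eq_mul_one_sub hh z ▸ hz)
  refine ⟨h1, h2, Matrix.inv_eq_right_inv ?_⟩
  have e1 : (a + z • b + z ^ 2 • c) * (z • 1 - g)⁻¹ = z • c + b + c * g := by
    rw [quadratic_eq_mul_sub hg, Matrix.mul_assoc,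
      Matrix.mul_nonsing_inv _ ((Matrix.isUnit_iff_isUnit_det _).1 h1), Matrix.mul_one]
  have e2 : (a + z • b + z ^ 2 • c) * (1 - z • h)⁻¹ = a + z • (b + a * h) := by
    rw [quadratic_eq_mul_one_sub hh, Matrix.mul_assoc,
      Matrix.mul_nonsing_inv _ ((Matrix.isUnit_iff_isUnit_det _).1 h2), Matrix.mul_one]
  rw [← Matrix.mul_assoc, Matrix.mul_add, ← Matrix.mul_assoc, e1, e2, ← hw]
  congr 1
  have e : c = -(b * h + a * (h * h)) := by
    rw [eq_neg_iff_add_eq_zero, ← hh]; abel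
  have e3 : z • c = -(z • (b + a * h) * h) := by
    rw [e, smul_neg, smul_mul_assoc, add_mul, Matrix.mul_assoc]
  rw [e3, add_mul]
  abel

variable {L : Matrix n α ℂ} {K : Matrix n β ℂ} {E : Matrix α n ℂ} {F : Matrix β n ℂ}
  {V₁ : Matrix α α ℂ} {V₀ : Matrix β β ℂ}

/-- The columns of `L` and `K` span complementary invariant subspaces of `h`, on which `h` acts
as `V₁` and `V₀`; the rows of `E` and `F` are the dual bases. -/
structure IsInvariantSplitting (h : Matrix n n ℂ) (L : Matrix n α ℂ) (K : Matrix n β ℂ)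
    (E : Matrix α n ℂ) (F : Matrix β n ℂ) (V₁ : Matrix α α ℂ) (V₀ : Matrix β β ℂ) : Prop where
  sum_eq_one : L * E + K * F = 1
  E_mul_L : E * L = 1
  E_mul_K : E * K = 0
  F_mul_L : F * L = 0
  F_mul_K : F * K = 1
  mul_L : h * L = L * V₁
  mul_K : h * K = K * V₀

theorem isInvariantSplitting_of_fromCols
    (h1 : Matrix.fromCols L K * Matrix.fromRows E F = 1)
    (h2 : Matrix.fromRows E F * Matrix.fromCols L K = 1)
    (h3 : h * Matrix.fromCols L K = Matrix.fromCols L K * Matrix.fromBlocks V₁ 0 0 V₀) :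
    IsInvariantSplitting h L K E F V₁ V₀ := by
  rw [Matrix.fromCols_mul_fromRows] at h1
  rw [Matrix.fromRows_mul_fromCols, ← Matrix.fromBlocks_one, Matrix.fromBlocks_inj] at h2
  rw [Matrix.mul_fromCols, Matrix.fromCols_mul_fromBlocks] at h3
  replace h3 := Matrix.fromCols_inj h3
  simp only [Matrix.mul_zero, add_zero, zero_add] at h3
  exact ⟨h1, h2.1, h2.2.1, h2.2.2.1, h2.2.2.2, h3.1, h3.2⟩

namespace IsInvariantSplitting

theorem E_mul (hs : IsInvariantSplitting h L K E F V₁ V₀) : E * h = V₁ * E := by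
  have e : E * h = E * (h * L) * E + E * (h * K) * F := by
    rw [← Matrix.mul_one (E * h), ← hs.sum_eq_one, Matrix.mul_add]
    simp only [Matrix.mul_assoc]
  rw [e, hs.mul_L, hs.mul_K, ← Matrix.mul_assoc, hs.E_mul_L, ← Matrix.mul_assoc, hs.E_mul_K]
  simp

theorem F_mul (hs : IsInvariantSplitting h L K E F V₁ V₀) : F * h = V₀ * F := by
  have e : F * h = F * (h * L) * E + F * (h * K) * F := by
    rw [← Matrix.mul_one (F * h), ← hs.sum_eq_one, Matrix.mul_add]
    simp only [Matrix.mul_assoc]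
  rw [e, hs.mul_L, hs.mul_K, ← Matrix.mul_assoc, hs.F_mul_L, ← Matrix.mul_assoc, hs.F_mul_K]
  simp

/-- Comparing traces of the two identity matrices. The count makes the decomposable matrix square,
so that a one-sided inverse suffices there. -/
theorem card_eq (hs : IsInvariantSplitting h L K E F V₁ V₀) :
    Fintype.card α + Fintype.card β = Fintype.card n := by
  have h1 : Matrix.fromCols L K * Matrix.fromRows E F = 1 := by
    rw [Matrix.fromCols_mul_fromRows, hs.sum_eq_one]
  have h2 : Matrix.fromRows E F * Matrix.fromCols L K = 1 := by
    rw [Matrix.fromRows_mul_fromCols, ← Matrix.fromBlocks_one, hs.E_mul_L, hs.E_mul_K, hs.F_mul_L,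
      hs.F_mul_K]
  rw [← Fintype.card_sum]
  have e1 := congrArg Matrix.trace h1
  rw [Matrix.trace_mul_comm, h2, Matrix.trace_one, Matrix.trace_one] at e1
  exact_mod_cast e1

/-- On an invariant subspace with dual basis `E`, `E (z h - 1)⁻¹ L` inverts `z V - 1`. -/
theorem resolvent_E (hs : IsInvariantSplitting h L K E F V₁ V₀) {z : ℂ} {H : Matrix n n ℂ}
    (hH : (z • h - 1) * H = 1) :
    (z • V₁ - 1) * (E * H * L) = 1 ∧ E * H * L * E = E * H := by
  have e1 : (z • V₁ - 1) * E = E * (z • h - 1) := by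
    rw [Matrix.sub_mul, Matrix.mul_sub, Matrix.smul_mul, Matrix.mul_smul, hs.E_mul, Matrix.one_mul,
      Matrix.mul_one]
  have e2 : (z • V₁ - 1) * (E * H * L) = 1 := by
    rw [← Matrix.mul_assoc, ← Matrix.mul_assoc, e1, Matrix.mul_assoc E, hH, Matrix.mul_one,
      hs.E_mul_L]
  refine ⟨e2, ?_⟩
  have e3 := mul_eq_one_comm.1 e2
  calc E * H * L * E = E * H * L * (E * ((z • h - 1) * H)) := by rw [hH, Matrix.mul_one]
    _ = E * H * L * (z • V₁ - 1) * (E * H) := by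
      rw [← Matrix.mul_assoc E, ← e1]
      simp only [Matrix.mul_assoc]
    _ = E * H := by rw [e3, Matrix.one_mul]

theorem symm (hs : IsInvariantSplitting h L K E F V₁ V₀) :
    IsInvariantSplitting h K L F E V₀ V₁ :=
  ⟨by rw [add_comm, hs.sum_eq_one], hs.F_mul_K, hs.F_mul_L, hs.E_mul_K, hs.E_mul_L, hs.mul_K,
    hs.mul_L⟩

/-- On `L`, the relation `L = h L V₁⁻¹` turns the expression into `(c + bh + ah²) L V₁⁻²`; on the
identity block it is the equation for `g`. -/
theorem finite_part (hs : IsInvariantSplitting h L K E F V₁ V₀) (hV : IsUnit V₁)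
    (hg : a + b * g + c * (g * g) = 0) (hh : c + b * h + a * (h * h) = 0) :
    ∑ i : Fin 3, (![a, b, c] : Fin 3 → Matrix n n ℂ) i * Matrix.fromCols (1 : Matrix n n ℂ) L *
      Matrix.fromBlocks g 0 0 V₁⁻¹ ^ (i : ℕ) = 0 := by
  have hLV : L = h * L * V₁⁻¹ := by
    rw [hs.mul_L, Matrix.mul_assoc,
      Matrix.mul_nonsing_inv _ ((Matrix.isUnit_iff_isUnit_det _).1 hV), Matrix.mul_one]
  have e : a * L + b * (L * V₁⁻¹) + c * (L * (V₁⁻¹ * V₁⁻¹)) = 0 := by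
    have e1 : b * (L * V₁⁻¹) = b * h * (L * (V₁⁻¹ * V₁⁻¹)) := by
      nth_rewrite 1 [hLV]; simp only [Matrix.mul_assoc]
    have e2 : a * L = a * (h * h) * (L * (V₁⁻¹ * V₁⁻¹)) := by
      nth_rewrite 1 [hLV]; nth_rewrite 1 [hLV]; simp only [Matrix.mul_assoc]
    rw [e1, e2, ← Matrix.add_mul, ← Matrix.add_mul]
    rw [show a * (h * h) + b * h + c = 0 by rw [← hh]; abel, Matrix.zero_mul]
  simp only [Fin.sum_univ_three, Matrix.cons_val_zero, Matrix.cons_val_one,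
    Matrix.cons_val, Fin.val_zero, Fin.val_one, Fin.val_two, pow_zero, pow_one, pow_two,
    Matrix.mul_one, Matrix.fromBlocks_multiply, Matrix.mul_assoc, Matrix.fromCols_mul_fromBlocks,
    Matrix.mul_zero, Matrix.zero_mul, add_zero, zero_add, Matrix.mul_fromCols,
    Matrix.fromCols_add_fromCols]
  rw [e, hg]
  ext i (j | j) <;> rfl

theorem infinite_part (hs : IsInvariantSplitting h L K E F V₁ V₀)
    (hh : c + b * h + a * (h * h) = 0) :
    ∑ i : Fin 3, (![a, b, c] : Fin 3 → Matrix n n ℂ) i * K * V₀ ^ (2 - (i : ℕ)) = 0 := by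
  have e1 : b * (K * V₀) = b * h * K := by rw [← hs.mul_K, Matrix.mul_assoc]
  have e2 : a * (K * (V₀ * V₀)) = a * (h * h) * K := by
    rw [← Matrix.mul_assoc K, ← hs.mul_K, Matrix.mul_assoc h, ← hs.mul_K]
    simp only [Matrix.mul_assoc]
  simp only [Fin.sum_univ_three, Matrix.cons_val_zero, Matrix.cons_val_one,
    Matrix.cons_val, Fin.val_zero, Fin.val_one, Fin.val_two, Nat.sub_zero, Nat.sub_self, pow_zero,
    pow_two, Matrix.mul_one, Matrix.mul_assoc, Nat.reduceSub, pow_one]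
  rw [e1, e2, ← Matrix.add_mul, ← Matrix.add_mul,
    show a * (h * h) + b * h + c = 0 by rw [← hh]; abel, Matrix.zero_mul]

theorem decomposableMatrix_inverse (hs : IsInvariantSplitting h L K E F V₁ V₀) (hV : IsUnit V₁)
    {D : Matrix n n ℂ} (hD : (1 - g * h) * D = 1) :
    ∃ N : Matrix ((n ⊕ α) ⊕ β) (Fin 2 × n) ℂ,
      decomposableMatrix 2 (Matrix.fromCols (1 : Matrix n n ℂ) L)
        (Matrix.fromBlocks g 0 0 V₁⁻¹) K V₀ * N = 1 ∧
      N * decomposableMatrix 2 (Matrix.fromCols (1 : Matrix n n ℂ) L)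
        (Matrix.fromBlocks g 0 0 V₁⁻¹) K V₀ = 1 := by
  have hVV : V₁⁻¹ * V₁ = 1 :=
    Matrix.nonsing_inv_mul _ ((Matrix.isUnit_iff_isUnit_det _).1 hV)
  -- As `L V₁ E + K V₀ F = h` and `L E + K F = 1`, multiplying the `L` and `K` columns by the rows
  -- `V₁E` and `F` reduces the matrix to `[[1, h], [g, 1]]`. Its inverse is `[[1 + hDg, -hD], [-Dg,
  -- D]]` with `D = (1 - gh)⁻¹`.
  set N : Fin 2 → Matrix ((n ⊕ α) ⊕ β) n ℂ :=
    ![Matrix.fromRows (Matrix.fromRows (1 + h * D * g) (-(V₁ * E * D * g))) (-(F * D * g)),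
      Matrix.fromRows (Matrix.fromRows (-(h * D)) (V₁ * E * D)) (F * D)] with hN
  set X : Fin 2 → Matrix n ((n ⊕ α) ⊕ β) ℂ := fun i =>
    Matrix.fromCols (Matrix.fromCols (1 : Matrix n n ℂ) L * Matrix.fromBlocks g 0 0 V₁⁻¹ ^ (i : ℕ))
      (K * V₀ ^ (2 - 1 - (i : ℕ))) with hX
  have hsplit : L * V₁ * E + K * V₀ * F = h := by
    rw [← hs.mul_L, ← hs.mul_K, Matrix.mul_assoc, Matrix.mul_assoc, ← Matrix.mul_add,
      hs.sum_eq_one, Matrix.mul_one]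
  have e0 : ∀ Y Y' : Matrix n n ℂ, X 0 * Matrix.fromRows (Matrix.fromRows Y (V₁ * E * Y'))
      (F * Y') = Y + h * Y' := by
    intro Y Y'
    simp only [hX, Fin.val_zero, pow_zero, Matrix.mul_one, Nat.sub_zero, Nat.reduceSub, pow_one,
      Matrix.fromCols_mul_fromRows, Matrix.one_mul]
    rw [← hsplit, Matrix.add_mul, add_assoc]
    simp only [Matrix.mul_assoc]
  have e1 : ∀ Y Y' : Matrix n n ℂ, X 1 * Matrix.fromRows (Matrix.fromRows Y (V₁ * E * Y'))
      (F * Y') = g * Y + Y' := by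
    intro Y Y'
    have e2 : L * V₁⁻¹ * (V₁ * E * Y') = L * E * Y' := by
      calc L * V₁⁻¹ * (V₁ * E * Y') = L * (V₁⁻¹ * V₁) * E * Y' := by simp only [Matrix.mul_assoc]
        _ = L * E * Y' := by rw [hVV, Matrix.mul_one]
    simp only [hX, Fin.val_one, pow_one, Nat.reduceSub, Nat.sub_self, pow_zero, Matrix.mul_one,
      Matrix.fromCols_mul_fromBlocks, Matrix.mul_zero, add_zero, zero_add,
      Matrix.fromCols_mul_fromRows, Matrix.one_mul]
    rw [e2, add_assoc, ← Matrix.mul_assoc K, ← Matrix.add_mul, hs.sum_eq_one, Matrix.one_mul]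
  have hgh : g * h * D = D - 1 := by
    rw [← hD, Matrix.sub_mul, Matrix.one_mul]; abel
  have n0 : N 0 = Matrix.fromRows (Matrix.fromRows (1 + h * D * g) (V₁ * E * -(D * g)))
      (F * -(D * g)) := by
    simp [hN, Matrix.mul_assoc]
  have n1 : N 1 = Matrix.fromRows (Matrix.fromRows (-(h * D)) (V₁ * E * D)) (F * D) := rfl
  have hXN : ∀ i j, X i * N j = if i = j then 1 else 0 := by
    intro i j
    fin_cases i <;> fin_cases j
    · simp only [Fin.zero_eta, if_true, n0, e0]; noncomm_ring
    · simp only [Fin.zero_eta, Fin.mk_one, n1, e0]; simp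
    · simp only [Fin.zero_eta, Fin.mk_one, n0, e1]
      simp only [Matrix.mul_add, ← Matrix.mul_assoc, hgh]; simp [Matrix.sub_mul]
    · simp only [Fin.mk_one, if_true, n1, e1]
      rw [Matrix.mul_neg, ← Matrix.mul_assoc, hgh]; abel
  have hmul : decomposableMatrix 2 (Matrix.fromCols (1 : Matrix n n ℂ) L)
      (Matrix.fromBlocks g 0 0 V₁⁻¹) K V₀ *
        (Matrix.of fun r (s : Fin 2 × n) => N s.1 r s.2) = 1 := by
    ext ⟨i, k⟩ ⟨j, l⟩
    have := congrFun (congrFun (hXN i j) k) l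
    refine Eq.trans ?_ (this.trans ?_)
    · rfl
    · by_cases hij : i = j <;> simp [hij, Matrix.one_apply]
  refine ⟨_, hmul, (Matrix.mul_eq_one_comm_of_card_eq _ _ _ ?_).1 hmul⟩
  have := hs.card_eq
  simp only [Fintype.card_prod, Fintype.card_sum, Fintype.card_fin]
  omega

theorem resolvent (hs : IsInvariantSplitting h L K E F V₁ V₀) (hV : IsUnit V₁)
    {z : ℂ} (hz1 : IsUnit (z • 1 - g)) (hz2 : IsUnit (1 - z • h)) :
    IsUnit (Matrix.fromBlocks (z • 1 - Matrix.fromBlocks g 0 0 V₁⁻¹) 0 0 (z • V₀ - 1)) ∧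
    Matrix.fromCols (Matrix.fromCols (1 : Matrix n n ℂ) L) K *
      (Matrix.fromBlocks (z • 1 - Matrix.fromBlocks g 0 0 V₁⁻¹) 0 0 (z • V₀ - 1))⁻¹ *
        Matrix.fromRows (Matrix.fromRows w (-(E * w))) (-(V₀ * F * w)) =
      ((z • 1 - g)⁻¹ + (1 - z • h)⁻¹ * h) * w := by
  have hVV : V₁ * V₁⁻¹ = 1 :=
    Matrix.mul_nonsing_inv _ ((Matrix.isUnit_iff_isUnit_det _).1 hV)
  set H := (1 - z • h)⁻¹ with hHdef
  have hH1 : (1 - z • h) * H = 1 :=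
    Matrix.mul_nonsing_inv _ ((Matrix.isUnit_iff_isUnit_det _).1 hz2)
  have hH : (z • h - 1) * -H = 1 := by
    rw [Matrix.mul_neg, ← Matrix.neg_mul, neg_sub, hH1]
  obtain ⟨hE, hE'⟩ := hs.resolvent_E hH
  obtain ⟨hF, hF'⟩ := hs.symm.resolvent_E hH
  have hcomm : h * H = H * h := by
    have h1 := mul_eq_one_comm.1 hH1
    calc h * H = H * (1 - z • h) * h * H := by rw [h1, Matrix.one_mul]
      _ = H * h * ((1 - z • h) * H) := by
        simp only [mul_sub, sub_mul, mul_smul_comm, smul_mul_assoc, mul_one, one_mul,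
          Matrix.mul_assoc]
      _ = H * h := by rw [hH1, Matrix.mul_one]
  set g' := (z • 1 - g)⁻¹ with hg'
  have hgg' : (z • 1 - g) * g' = 1 :=
    Matrix.mul_nonsing_inv _ ((Matrix.isUnit_iff_isUnit_det _).1 hz1)
  -- From `(z - V₁⁻¹) V₁ = z V₁ - 1`, whose inverse is provided by `resolvent_E`.
  have hV1 : (z • 1 - V₁⁻¹) * (V₁ * (E * -H * L)) = 1 := by
    have h1 := mul_eq_one_comm.1 hVV
    rw [← Matrix.mul_assoc, Matrix.sub_mul, h1, Matrix.smul_mul, Matrix.one_mul, hE]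
  have hT : Matrix.fromBlocks (z • 1 - Matrix.fromBlocks g 0 0 V₁⁻¹) 0 0 (z • V₀ - 1) *
      Matrix.fromBlocks (Matrix.fromBlocks g' 0 0 (V₁ * (E * -H * L))) 0 0 (F * -H * K) = 1 := by
    have e : z • (1 : Matrix (n ⊕ α) (n ⊕ α) ℂ) - Matrix.fromBlocks g 0 0 V₁⁻¹ =
        Matrix.fromBlocks (z • 1 - g) 0 0 (z • 1 - V₁⁻¹) := by
      rw [← Matrix.fromBlocks_one, Matrix.fromBlocks_smul, sub_eq_add_neg, Matrix.fromBlocks_neg,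
        Matrix.fromBlocks_add]
      simp [sub_eq_add_neg]
    rw [e]
    simp only [Matrix.fromBlocks_multiply, Matrix.mul_zero, Matrix.zero_mul, add_zero, zero_add,
      hgg', hV1, hF, Matrix.fromBlocks_one]
  refine ⟨IsUnit.of_mul_eq_one _ hT, ?_⟩
  rw [Matrix.inv_eq_right_inv hT]
  simp only [Matrix.fromCols_mul_fromBlocks, Matrix.fromCols_mul_fromRows, Matrix.mul_zero,
    add_zero, zero_add, Matrix.one_mul]
  have e1 : L * (V₁ * (E * -H * L)) * -(E * w) = L * E * (h * H) * w := by
    calc L * (V₁ * (E * -H * L)) * -(E * w) = -(L * (V₁ * (E * -H * L * E)) * w) := by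
          simp only [Matrix.mul_neg, Matrix.mul_assoc]
      _ = L * (V₁ * E * H) * w := by
          rw [hE']; simp only [Matrix.mul_neg, Matrix.neg_mul, neg_neg, Matrix.mul_assoc]
      _ = L * E * (h * H) * w := by rw [← hs.E_mul]; simp only [Matrix.mul_assoc]
  have e2 : K * (F * -H * K) * -(V₀ * F * w) = K * F * (h * H) * w := by
    calc K * (F * -H * K) * -(V₀ * F * w) = K * (F * -H * K * F) * -(h * w) := by
          rw [← hs.F_mul]; simp only [Matrix.mul_neg, Matrix.mul_assoc]
      _ = K * F * (h * H) * w := by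
          rw [hF', hcomm]; simp only [Matrix.mul_neg, Matrix.neg_mul, neg_neg, Matrix.mul_assoc]
  rw [e1, e2, add_assoc, ← Matrix.add_mul, ← Matrix.add_mul, ← Matrix.add_mul, hs.sum_eq_one,
    Matrix.one_mul, hcomm]

end IsInvariantSplitting

theorem isResolventTriple_of_solvents (hc : c ≠ 0) (hg : a + b * g + c * (g * g) = 0)
    (hh : c + b * h + a * (h * h) = 0) (hw : (c * g + b + a * h) * w = 1)
    {D : Matrix n n ℂ} (hD : (1 - g * h) * D = 1)
    (hreg : ∃ z : ℂ, IsUnit (a + z • b + z ^ 2 • c))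
    (hs : IsInvariantSplitting h L K E F V₁ V₀) (hV : IsUnit V₁) :
    IsResolventTriple (l := 2) ![a, b, c] (Matrix.fromCols (1 : Matrix n n ℂ) L)
      (Matrix.fromBlocks g 0 0 V₁⁻¹) K V₀ (Matrix.fromRows w (-(E * w))) (-(V₀ * F * w)) where
  decomposable :=
    { degree := hc
      nonsingular := hs.decomposableMatrix_inverse hV hD
      finite_part := hs.finite_part hV hg hh
      infinite_part := hs.infinite_part hh }
  regular := by
    obtain ⟨z, hz⟩ := hreg
    exact ⟨z, by rwa [matPolyEval_quadratic]⟩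
  resolvent := by
    intro z hz
    rw [matPolyEval_quadratic] at hz ⊢
    obtain ⟨h1, h2, h3⟩ := quadratic_inv hg hh hw hz
    obtain ⟨h4, h5⟩ := hs.resolvent (w := w) hV h1 h2
    exact ⟨h4, h3.trans h5.symm⟩

/-- The polynomial factors as `(z r - 1) u (z - g)`, so it is invertible at every nonzero `z`
outside the spectrum of `g` and the reciprocals of the spectrum of `r`. For the QBD, `r` is `R` and
`u` is `I - A₀ - A₁G`. -/
theorem exists_isUnit_quadratic (hg : a + b * g + c * (g * g) = 0) {r u : Matrix n n ℂ}
    (hu : IsUnit u) (hru : r * u = c) (hbg : b + c * g = -u) :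
    ∃ z : ℂ, IsUnit (a + z • b + z ^ 2 • c) := by
  have hfin : ({0} ∪ spectrum ℂ g ∪ (spectrum ℂ r).image (fun z : ℂ => z⁻¹) : Set ℂ).Finite :=
    ((Set.finite_singleton 0).union (Matrix.finite_spectrum g)).union
      ((Matrix.finite_spectrum r).image _)
  obtain ⟨z, hz⟩ := hfin.exists_notMem
  simp only [Set.mem_union, Set.mem_singleton_iff, not_or] at hz
  obtain ⟨⟨hz0, hzg⟩, hzr⟩ := hz
  refine ⟨z, ?_⟩
  have h1 : IsUnit (z • 1 - g) := by
    rw [spectrum.mem_iff, not_not, Algebra.algebraMap_eq_smul_one] at hzg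
    exact hzg
  have h2 : IsUnit (z • r - 1) := by
    have h3 : z⁻¹ ∉ spectrum ℂ r := fun hmem => hzr ⟨z⁻¹, hmem, inv_inv z⟩
    rw [spectrum.mem_iff, not_not, Algebra.algebraMap_eq_smul_one] at h3
    have h4 : z • r - 1 = -z • (z⁻¹ • (1 : Matrix n n ℂ) - r) := by
      rw [smul_sub, smul_smul, neg_mul, mul_inv_cancel₀ hz0]
      simp only [neg_smul, one_smul]
      abel
    rw [h4]
    exact (h3.smul (Units.mk0 (-z) (neg_ne_zero.2 hz0)))
  have e : z • c + b + c * g = (z • r - 1) * u := by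
    rw [add_assoc, hbg, Matrix.sub_mul, Matrix.one_mul, Matrix.smul_mul, hru, sub_eq_add_neg]
  rw [quadratic_eq_mul_sub hg, e]
  exact (h2.mul hu).mul h1

end Solvents

theorem theorem3p3 {m : ℕ} (Q : QBD m)
    (hP : Q.P.IsIrreducible)
    (hA : (Q.Adown + Q.A0 + Q.Aup).IsIrreducible)
    (hfinal : Q.HasUniqueFinalClass)
    (hQ : Q.NotNullRecurrent) :
    -- the objects that enter the triple are well defined
    IsMinimalNonneg Q.GEquation Q.G ∧
    IsMinimalNonneg Q.GhatEquation Q.Ghat ∧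
    IsMinimalNonneg Q.REquation Q.R ∧
    IsUnit (Q.U - 1) ∧
    Summable Q.WTerm ∧
    -- the resolvent triple, for every choice of `M = [L | K]`, `M⁻¹ = [E; F]`, `V₁` and `V₀`
    ∀ (p q : ℕ) (L : Matrix (Fin m) (Fin p) ℂ) (K : Matrix (Fin m) (Fin q) ℂ)
      (E : Matrix (Fin p) (Fin m) ℂ) (F : Matrix (Fin q) (Fin m) ℂ)
      (V₁ : Matrix (Fin p) (Fin p) ℂ) (V₀ : Matrix (Fin q) (Fin q) ℂ),
      Matrix.fromCols L K * Matrix.fromRows E F = 1 →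
      Matrix.fromRows E F * Matrix.fromCols L K = 1 →
      Q.Ghat.map Complex.ofReal * Matrix.fromCols L K =
        Matrix.fromCols L K * Matrix.fromBlocks V₁ 0 0 V₀ →
      IsUnit V₁ →
      spectralRadius ℂ V₀ = 0 →
      IsResolventTriple Q.eta
        (Matrix.fromCols 1 L) (Matrix.fromBlocks (Q.G.map Complex.ofReal) 0 0 V₁⁻¹)
        K V₀
        (Matrix.fromRows (Q.W.map Complex.ofReal) (-(E * Q.W.map Complex.ofReal)))
        (-(V₀ * F * Q.W.map Complex.ofReal)) := by
  have := hfinal.nonempty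
  have h := hfinal.reachesBelow
  have hr := hfinal.rev_reachesBelow
  have hsum := QBD.summable_green h hP hA hQ
  refine ⟨Q.isMinimal_G, Q.isMinimal_Ghat, QBD.isMinimal_R h, QBD.isUnit_U_sub_one h, ?_, ?_⟩
  · exact hsum.neg.congr fun j => (QBD.WTerm_eq h j).symm
  intro p q L K E F V₁ V₀ h1 h2 h3 hV _
  -- Entrywise complexification is a ring homomorphism, so all the real identities carry over.
  let φ : Matrix (Fin m) (Fin m) ℝ →+* Matrix (Fin m) (Fin m) ℂ := Complex.ofRealHom.mapMatrix
  have hφ : ∀ A : Matrix (Fin m) (Fin m) ℝ, A.map Complex.ofReal = φ A := fun _ => rfl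
  have hφinj : Function.Injective φ := Matrix.map_injective Complex.ofReal_injective
  have hg : φ Q.Adown + φ (Q.A0 - 1) * φ Q.G + φ Q.Aup * (φ Q.G * φ Q.G) = 0 := by
    have h4 := congrArg φ Q.isMinimal_G.2.1
    simpa only [map_add, map_mul, map_pow, map_zero, pow_two] using h4
  have hh : φ Q.Aup + φ (Q.A0 - 1) * φ Q.Ghat + φ Q.Adown * (φ Q.Ghat * φ Q.Ghat) = 0 := by
    have h4 := congrArg φ Q.isMinimal_Ghat.2.1
    simpa only [map_add, map_mul, map_pow, map_zero, pow_two] using h4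
  have hw := congrArg φ (QBD.mul_W_eq_one h hr hsum)
  have hD := congrArg φ (QBD.one_sub_G_mul_Ghat_mul_eq_one h hr hsum)
  have hru := congrArg φ (QBD.R_mul_one_sub_excursion h)
  simp only [map_add, map_mul, map_one] at hw
  rw [map_mul, map_sub φ 1, map_mul φ Q.G, map_one] at hD
  rw [map_mul] at hru
  refine isResolventTriple_of_solvents ?_ hg hh hw hD ?_
    (isInvariantSplitting_of_fromCols h1 h2 h3) hV
  · have := hr.Adown_ne_zero
    exact fun h0 => this (hφinj (h0.trans (map_zero φ).symm))
  · refine exists_isUnit_quadratic hg ((QBD.isUnit_one_sub_excursion h).map φ) hru ?_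
    change φ (Q.A0 - 1) + φ Q.Aup * φ Q.G = -φ (1 - Q.excursion)
    rw [← map_mul, ← map_add, ← map_neg, QBD.excursion]
    congr 1
    abel
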